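/- Theorem (Dense doping). Let $N\ge 2$ be even and consider a periodic chain of $N$ qubits with sites $1,\dots,N$ (indices mod $N$). Let $D$ be a set of doped sites such that no two adjacent sites are both undoped. Let $u=i\mathrm{SWAP}\,(H\otimes H)$, where $i\mathrm{SWAP}=\exp[\tfrac{i\pi}{4}(X\otimes X+Y\otimes Y)]$ and $H$ is the Hadamard gate, and let $$U \;=\; W_2\Big(\prod_{j \text{ even}} u_{j,j+1}\Big)\,W_1\Big(\prod_{j\text{ odd}}u_{j,j+1}\Big),\qquad W_k=\bigotimes_{j\in D}V_{k;j},$$ where the single-qubit unitaries $V_{k;j}$ ($k\in\{1,2\}$, $j\in D$) are independent and Haar distributed and $W_k$ acts as the identity on the undoped sites. For $\gamma\in\mathbb R$ let $\mathcal N_\gamma$ be the on-site depolarizing layer, i.e. the linear map on $N$-qubit operators with $\mathcal N_\gamma(S)=e^{-\gamma w(S)}S$ for every Pauli string $S$, where $w(S)$ is the number of sites on which $S$ acts nontrivially. Let $\Phi_\gamma(A)=\mathcal N_\gamma(UAU^\dagger)$ be the one-period Floquet channel and, writing its eigenvalues as $e^{\lambda_a}$ with $\lambda_0=0$ for the steady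 state, let $\Delta(\gamma)=-\max_{a\ne0}\mathrm{Re}\,\lambda_a$ be its Liouvillian gap. Then, for every such $N$ and $D$ and with probability one over the Haar rotations, in the limit $\gamma\to\infty$ $$\Delta(\gamma)\;\le\;3\gamma+3 ,$$ i.e. there is $\gamma_0$ (which may depend on the circuit) such that the inequality holds for all $\gamma\ge\gamma_0$. In particular, the slope and the constant of the bound do not depend on $N$. -/

import Mathlib

open MeasureTheory Filter
open scoped Kronecker Matrix

namespace DopedClifford

noncomputable section

/-! ### Single-qubit and two-qubit matrices -/

/-- The Pauli matrices `I, X, Y, Z`, indexed by `0, 1, 2, 3`. -/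
def pauli : Fin 4 → Matrix (Fin 2) (Fin 2) ℂ :=
  ![1, !![0, 1; 1, 0], !![0, -Complex.I; Complex.I, 0], !![1, 0; 0, -1]]

/-- The Hadamard matrix. -/
def hadamard : Matrix (Fin 2) (Fin 2) ℂ :=
  ((Real.sqrt 2 : ℝ) : ℂ)⁻¹ • !![1, 1; 1, -1]

/-- The gate `iSWAP = exp (i π / 4 (X ⊗ X + Y ⊗ Y))`, written out: it fixes `|00⟩` and `|11⟩`
and exchanges `|01⟩` and `|10⟩` with the phase `i`; `iSWAP_eq_exp` is the exponential form. -/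
def iSWAP : Matrix (Fin 2 × Fin 2) (Fin 2 × Fin 2) ℂ :=
  Matrix.of fun p q =>
    if p = (q.2, q.1) then (if p.1 = p.2 then 1 else Complex.I) else 0

theorem iSWAP_eq_exp :
    iSWAP = NormedSpace.exp
      ((Complex.I * (Real.pi : ℂ) / 4) • (pauli 1 ⊗ₖ pauli 1 + pauli 2 ⊗ₖ pauli 2)) := by
  -- diagonalise the exponent in the basis `00, 11, 01 + 10, 01 - 10`
  let P : Matrix (Fin 2 × Fin 2) (Fin 2 × Fin 2) ℂ := Matrix.of fun p q =>
    if p.1 = p.2 then (if p = q then 1 else 0)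
    else if q.1 = q.2 then 0 else if p = (1, 0) ∧ q = (1, 0) then -1 else 1
  let Q : Matrix (Fin 2 × Fin 2) (Fin 2 × Fin 2) ℂ := Matrix.of fun p q =>
    if p.1 = p.2 then (if p = q then 1 else 0)
    else if q.1 = q.2 then 0 else if p = (1, 0) ∧ q = (1, 0) then -1 / 2 else 1 / 2
  let v : Fin 2 × Fin 2 → ℂ := fun p =>
    if p.1 = p.2 then 0 else if p = (0, 1) then Complex.I * Real.pi / 2
      else -(Complex.I * Real.pi / 2)
  have hPQ : P * Q = 1 := by
    ext ⟨a, b⟩ ⟨c, d⟩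
    fin_cases a <;> fin_cases b <;> fin_cases c <;> fin_cases d <;>
      simp [P, Q, Matrix.mul_apply, Fintype.sum_prod_type, Fin.sum_univ_two] <;>
      norm_num
  have hinv : P⁻¹ = Q := Matrix.inv_eq_right_inv hPQ
  have hunit : IsUnit P := by
    rw [Matrix.isUnit_iff_isUnit_det]
    exact Matrix.isUnit_det_of_right_inverse hPQ
  have hA : (Complex.I * (Real.pi : ℂ) / 4) • (pauli 1 ⊗ₖ pauli 1 + pauli 2 ⊗ₖ pauli 2)
      = P * Matrix.diagonal v * P⁻¹ := by
    rw [hinv]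
    ext ⟨a, b⟩ ⟨c, d⟩
    fin_cases a <;> fin_cases b <;> fin_cases c <;> fin_cases d <;>
      simp [P, Q, v, pauli, Matrix.mul_apply, Fintype.sum_prod_type, Fin.sum_univ_two,
        Matrix.diagonal_apply] <;> ring
  have h1 : Complex.exp (Complex.I * Real.pi / 2) = Complex.I := by
    rw [show Complex.I * (Real.pi : ℂ) / 2 = Real.pi / 2 * Complex.I by ring,
      Complex.exp_pi_div_two_mul_I]
  have h2 : Complex.exp (-(Complex.I * Real.pi / 2)) = -Complex.I := by
    rw [Complex.exp_neg, h1, Complex.inv_I]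
  rw [hA, Matrix.exp_conj _ _ hunit, Matrix.exp_diagonal, hinv, Pi.exp_def]
  ext ⟨a, b⟩ ⟨c, d⟩
  fin_cases a <;> fin_cases b <;> fin_cases c <;> fin_cases d <;>
    simp [iSWAP, P, Q, v, ← Complex.exp_eq_exp_ℂ, h1, h2, Matrix.mul_apply, Fintype.sum_prod_type,
      Fin.sum_univ_two, Matrix.diagonal_apply] <;> ring

/-- The fixed two-qubit Clifford gate `u = iSWAP (H ⊗ H)`. -/
def gate : Matrix (Fin 2 × Fin 2) (Fin 2 × Fin 2) ℂ :=
  iSWAP * (hadamard ⊗ₖ hadamard)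

/-! ### The periodic chain of `N = 2 * L` qubits -/

/-- The sites of the periodic chain of `2 * L` qubits. -/
abbrev Site (L : ℕ) : Type := ZMod (2 * L)

/-- The labels of the computational basis of the chain. -/
abbrev BasisState (L : ℕ) : Type := Site L → Fin 2

/-- Operators on the `2 * L` qubits. -/
abbrev Op (L : ℕ) : Type := Matrix (BasisState L) (BasisState L) ℂ

/-- The tensor product over all sites `j` of the single-qubit matrices `A j`. -/
def siteLayer {L : ℕ} [NeZero L] (A : Site L → Matrix (Fin 2) (Fin 2) ℂ) : Op L :=
  Matrix.of fun x y => ∏ j, A j (x j) (y j)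

/-- The tensor product of copies of the gate `u` over the bonds `(2 i + s, 2 i + s + 1)`,
`0 ≤ i < L`, of the periodic chain. The two layers of the brickwork are `s = 0` and `s = 1`. -/
def bondLayer (L : ℕ) (s : ℕ) : Op L :=
  Matrix.of fun x y => ∏ i : Fin L,
    gate (x ((2 * (i : ℕ) + s : ℕ) : Site L), x ((2 * (i : ℕ) + s + 1 : ℕ) : Site L))
      (y ((2 * (i : ℕ) + s : ℕ) : Site L), y ((2 * (i : ℕ) + s + 1 : ℕ) : Site L))

/-- The Pauli string `⨂ j, σ_(μ j)`. -/
def pauliString {L : ℕ} [NeZero L] (μ : Site L → Fin 4) : Op L :=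
  siteLayer fun j => pauli (μ j)

/-- The weight of a Pauli string: the number of sites on which it is not the identity. -/
def weight {L : ℕ} [NeZero L] (μ : Site L → Fin 4) : ℕ :=
  (Finset.univ.filter fun j => μ j ≠ 0).card

/-! ### Haar doping -/

/-- The single-qubit unitaries. -/
abbrev U2 : Type := Matrix.unitaryGroup (Fin 2) ℂ

instance : MeasurableSpace U2 := borel U2

instance : BorelSpace U2 := ⟨rfl⟩

instance : CompactSpace U2 := by
  have hc : IsCompact
      {A : Matrix (Fin 2) (Fin 2) ℂ | ∀ i j, A i j ∈ Metric.closedBall (0 : ℂ) 1} := by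
    have h : IsCompact (Set.pi Set.univ fun _ : Fin 2 =>
        Set.pi Set.univ fun _ : Fin 2 => Metric.closedBall (0 : ℂ) 1) :=
      isCompact_univ_pi fun _ => isCompact_univ_pi fun _ => isCompact_closedBall 0 1
    have he : {A : Matrix (Fin 2) (Fin 2) ℂ | ∀ i j, A i j ∈ Metric.closedBall (0 : ℂ) 1} =
        (Set.pi Set.univ fun _ : Fin 2 =>
          Set.pi Set.univ fun _ : Fin 2 => Metric.closedBall (0 : ℂ) 1) := by
      ext A
      exact ⟨fun hA i _ j _ => hA i j, fun hA i j => hA i trivial j trivial⟩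
    rw [he]
    exact h
  have hcl : IsClosed ((Matrix.unitaryGroup (Fin 2) ℂ : Set (Matrix (Fin 2) (Fin 2) ℂ))) :=
    isClosed_unitary
  refine isCompact_iff_compactSpace.mp (hc.of_isClosed_subset hcl ?_)
  intro A hA i j
  simpa using entry_norm_bound_of_unitary hA i j

/-- The Haar probability measure on the single-qubit unitaries. -/
def haarU2 : Measure U2 := Measure.haarMeasure ⊤

instance : IsProbabilityMeasure haarU2 := ⟨by
  have h := Measure.haarMeasure_self (G := U2) (K₀ := ⊤)
  simpa [haarU2] using h⟩

/-- The rotations of a doped circuit: one for each of the two layers and each doped site. -/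
abbrev Rotations {L : ℕ} (D : Finset (Site L)) : Type := Fin 2 × {j // j ∈ D} → U2

/-- The law of the rotations: independent and Haar distributed. -/
def haarRotations {L : ℕ} (D : Finset (Site L)) : Measure (Rotations D) :=
  Measure.pi fun _ => haarU2

/-- The doping layer after the `k`-th brickwork layer: the rotations on the doped sites, the
identity on the undoped ones. -/
def dopingLayer {L : ℕ} [NeZero L] (D : Finset (Site L)) (V : Rotations D) (k : Fin 2) : Op L :=
  siteLayer fun j => if h : j ∈ D then (V (k, ⟨j, h⟩) : Matrix (Fin 2) (Fin 2) ℂ) else 1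

/-- The unitary stage of one Floquet period. -/
def floquetUnitary {L : ℕ} [NeZero L] (D : Finset (Site L)) (V : Rotations D) : Op L :=
  dopingLayer D V 1 * bondLayer L 1 * (dopingLayer D V 0 * bondLayer L 0)

/-- No two adjacent sites of the periodic chain are both undoped. -/
def IsDenseDoping {L : ℕ} (D : Finset (Site L)) : Prop :=
  ∀ j : Site L, j ∉ D → j + 1 ∈ D

/-! ### The Floquet channel and its Liouvillian gap -/

/-- The on-site depolarizing layer of strength `γ`: it multiplies the component of an operator
along a Pauli string of weight `w` by `exp (-γ w)`. -/
def noise (L : ℕ) [NeZero L] (γ : ℝ) : Module.End ℂ (Op L) :=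
  ∑ μ : Site L → Fin 4,
    ((Real.exp (-γ * weight μ) : ℝ) / 2 ^ (2 * L) : ℂ) •
      (Matrix.traceLinearMap (BasisState L) ℂ ℂ ∘ₗ LinearMap.mulLeft ℂ (pauliString μ)).smulRight
        (pauliString μ)

theorem siteLayer_mul {L : ℕ} [NeZero L] (A B : Site L → Matrix (Fin 2) (Fin 2) ℂ) :
    siteLayer A * siteLayer B = siteLayer fun j => A j * B j := by
  ext x y
  simp only [siteLayer, Matrix.mul_apply, Matrix.of_apply, ← Finset.prod_mul_distrib]
  exact (Fintype.prod_sum fun j k => A j (x j) k * B j k (y j)).symm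

theorem trace_siteLayer {L : ℕ} [NeZero L] (A : Site L → Matrix (Fin 2) (Fin 2) ℂ) :
    (siteLayer A).trace = ∏ j, (A j).trace := by
  simp only [siteLayer, Matrix.trace, Matrix.diag_apply, Matrix.of_apply]
  exact (Fintype.prod_sum fun j k => A j k k).symm

theorem noise_pauliString {L : ℕ} [NeZero L] (γ : ℝ) (μ : Site L → Fin 4) :
    noise L γ (pauliString μ) = (Real.exp (-γ * weight μ) : ℂ) • pauliString μ := by
  have htr : ∀ ν : Site L → Fin 4,
      (pauliString ν * pauliString μ).trace = if ν = μ then (2 : ℂ) ^ (2 * L) else 0 := by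
    intro ν
    have h1 : ∀ a b : Fin 4, (pauli a * pauli b).trace = if a = b then (2 : ℂ) else 0 := by
      intro a b
      fin_cases a <;> fin_cases b <;>
        simp [pauli, Matrix.trace, Fin.sum_univ_two] <;> norm_num
    rw [pauliString, pauliString, siteLayer_mul, trace_siteLayer]
    simp only [h1]
    split_ifs with h
    · subst h
      simp [ZMod.card]
    · obtain ⟨j, hj⟩ := Function.ne_iff.mp h
      exact Finset.prod_eq_zero (Finset.mem_univ j) (by simp [hj])
  simp only [noise, LinearMap.sum_apply, LinearMap.smul_apply, LinearMap.smulRight_apply,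
    LinearMap.comp_apply, LinearMap.mulLeft_apply, Matrix.traceLinearMap_apply, htr]
  rw [Finset.sum_eq_single μ]
  · simp [smul_smul]
  · intro ν _ hν
    simp [hν]
  · simp

/-- The one-period Floquet channel `A ↦ 𝒩 (U A U†)`. -/
def floquetChannel {L : ℕ} [NeZero L] (D : Finset (Site L)) (V : Rotations D) (γ : ℝ) :
    Module.End ℂ (Op L) :=
  noise L γ ∘ₗ LinearMap.mulLeftRight ℂ (floquetUnitary D V, (floquetUnitary D V)ᴴ)

/-- The Liouvillian gap of a one-period channel `Φ`, with the period as the unit of time: writing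
its nonzero eigenvalues as `exp l`, it is `-max Re l` over those different from the eigenvalue `1`
of the steady state. -/
def liouvillianGap {E : Type*} [AddCommGroup E] [Module ℂ E] (Φ : Module.End ℂ E) : ℝ :=
  -sSup {r : ℝ | ∃ l : ℂ, Φ.HasEigenvalue (Complex.exp l) ∧ Complex.exp l ≠ 1 ∧ l.re = r}

end

end DopedClifford

/-! In the basis of Pauli strings, the channel on traceless operators is a matrix T(x), x = exp
(-γ), whose row μ is x ^ `weight μ` times the row μ of the conjugation by U. Hence tr T(x)^n is a
polynomial in x, and its coefficient of x^s is the total amplitude of the closed paths of n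
nontrivial strings with total weight s. If such a coefficient is nonzero for some s < 3n, then |tr
T(x)^n| exceeds every fixed multiple of x^(3n) as x tends to 0, so some eigenvalue is larger than
exp (-3) x^3; it is not 1, because all eigenvalues of T(x) are O(x). This is
`eventually_liouvillianGap_le`. Since s < 3n is strict, the additive constant 3 could be any real
number.

The coefficient is a real-analytic function of the rotations, so it is nonzero almost surely as soon
as it is nonzero for one choice of them (`ae_loopAmplitude_ne_zero`). At Clifford rotations T(x) is
a signed permutation of strings with monomial entries, and an even power of it has no cancellation
in the trace. It thus suffices to find Clifford rotations and a string whose weight is at most 3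
along its orbit and below 3 once (`IsClifford.exists_coeff_trace_ne_zero`).

That string is a soliton on three consecutive sites which advances by one site per layer
(`soliton_step`). The gate sends X ⊗ I to I ⊗ Z up to sign, so at an undoped site a front X passes
on without leaving a trace. The middle site is then empty and the weight is at most 2. Dense doping
ensures that the neighbours of an undoped site carry rotations which restore the shape. -/

namespace DopedClifford

noncomputable section

/-! ### Analytic and spectral preliminaries -/

/-- A real-analytic function on a finite-dimensional space that does not vanish identically is
nonzero almost everywhere. -/
theorem ae_ne_zero_of_analyticOnNhd {E : Type*} [NormedAddCommGroup E] [NormedSpace ℝ E]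
    [FiniteDimensional ℝ E] [MeasurableSpace E] [BorelSpace E] (μ : Measure E)
    [μ.IsAddHaarMeasure] {f : E → ℂ} (hf : AnalyticOnNhd ℝ f Set.univ) {x₀ : E}
    (hx₀ : f x₀ ≠ 0) : ∀ᵐ x ∂μ, f x ≠ 0 := by
  have hcont : Continuous f := by
    rw [← continuousOn_univ]; exact hf.continuousOn
  -- On each line through x₀ the function is analytic in one variable and nonzero at t = 0, so its
  -- zeros form a null set; Fubini then exchanges t and x.
  have hline : ∀ x : E, ∀ᵐ t : ℝ, f (t • x + x₀) ≠ 0 := by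
    intro x
    have han : AnalyticOnNhd ℝ (fun t : ℝ => f (t • x + x₀)) Set.univ := fun t _ =>
      AnalyticAt.fun_comp (g := f) (f := fun t : ℝ => t • x + x₀) (hf (t • x + x₀) trivial) (by fun_prop)
    have h := han.preimage_zero_mem_codiscrete (x := 0) (by simpa using hx₀)
    have h2 := ae_restrict_le_codiscreteWithin (μ := volume) (U := (Set.univ : Set ℝ))
      MeasurableSet.univ h
    rw [Measure.restrict_univ] at h2
    filter_upwards [h2] with t ht
    simpa using ht
  have hswap : ∀ᵐ t : ℝ, ∀ᵐ x ∂μ, f (t • x + x₀) ≠ 0 := by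
    rw [← Measure.ae_ae_comm (μ := μ) (ν := (volume : Measure ℝ))
      (p := fun x t => f (t • x + x₀) ≠ 0)]
    · exact Eventually.of_forall hline
    · exact (isOpen_ne_fun (by fun_prop) continuous_const).measurableSet
  have hne : ∀ᵐ t : ℝ, t ≠ 0 := by
    simp [ae_iff]
  -- For a single t ≠ 0, dilation by t and translation by x₀ carry null sets to null sets, which
  -- returns the statement to f itself.
  obtain ⟨t, ht, ht0⟩ := (hswap.and hne).exists
  have h1 : ∀ᵐ x ∂μ, f (x + x₀) ≠ 0 := by
    have hmap : Measure.map (t⁻¹ • · : E → E) μ ≪ μ := by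
      rw [Measure.map_addHaar_smul μ (inv_ne_zero ht0)]
      exact Measure.smul_absolutelyContinuous
    have := (Measure.QuasiMeasurePreserving.mk (measurable_const_smul t⁻¹) hmap).ae ht
    filter_upwards [this] with x hx
    simpa [smul_smul, ht0] using hx
  have h2 : ∀ᵐ x ∂μ, f ((x + -x₀) + x₀) ≠ 0 :=
    (measurePreserving_add_right μ (-x₀)).quasiMeasurePreserving.ae h1
  simpa using h2

/-- A bound on all eigenvalues of a complex matrix bounds the traces of its powers. -/
theorem norm_trace_pow_le {n : Type*} [Fintype n] [DecidableEq n] (A : Matrix n n ℂ) {B : ℝ}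
    (hA : ∀ z ∈ spectrum ℂ A, ‖z‖ ≤ B) {k : ℕ} (hk : 0 < k) :
    ‖(A ^ k).trace‖ ≤ Fintype.card n * B ^ k := by
  rw [Matrix.trace_eq_sum_roots_charpoly]
  have hroots : ∀ z ∈ (A ^ k).charpoly.roots, ‖z‖ ≤ B ^ k := by
    intro z hz
    have h1 : z ∈ spectrum ℂ (A ^ k) :=
      Matrix.mem_spectrum_of_isRoot_charpoly (Polynomial.isRoot_of_mem_roots hz)
    rw [spectrum.map_pow_of_pos A hk] at h1
    obtain ⟨w, hw, rfl⟩ := h1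
    simpa using pow_le_pow_left₀ (norm_nonneg w) (hA w hw) k
  have h2 : ‖(A ^ k).charpoly.roots.sum‖ ≤ ((A ^ k).charpoly.roots.map fun z => ‖z‖).sum :=
    norm_multiset_sum_le _
  refine h2.trans ((Multiset.sum_le_card_nsmul _ (B ^ k) ?_).trans ?_)
  · intro x hx
    obtain ⟨z, hz, rfl⟩ := Multiset.mem_map.mp hx
    exact hroots z hz
  · have hcard : Multiset.card (A ^ k).charpoly.roots = Fintype.card n := by
      rw [← Matrix.charpoly_natDegree_eq_dim (A ^ k)]
      exact (IsAlgClosed.splits _).natDegree_eq_card_roots.symm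
    rw [Multiset.card_map, hcard, nsmul_eq_mul]

/-- A polynomial with a nonzero coefficient of degree below `m` dominates `x ^ m` as `x` tends
to zero. -/
theorem eventually_lt_norm_eval {p : Polynomial ℂ} {s m : ℕ} (hs : s < m) (hp : p.coeff s ≠ 0)
    (C : ℝ) : ∀ᶠ x : ℝ in nhdsWithin 0 (Set.Ioi 0), C * x ^ m < ‖p.eval (x : ℂ)‖ := by
  have hp0 : p ≠ 0 := by
    rintro rfl
    simp at hp
  -- The lowest-order term of p decides: after division by x ^ k, the polynomial has a nonzero limit
  -- while C * x ^ (m - k) tends to 0.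
  set k := p.natTrailingDegree with hk
  have hks : k ≤ s := Polynomial.natTrailingDegree_le_of_ne_zero hp
  obtain ⟨r, hr⟩ : Polynomial.X ^ k ∣ p := by
    rw [Polynomial.X_pow_dvd_iff]
    intro d hd
    exact Polynomial.coeff_eq_zero_of_lt_natTrailingDegree hd
  have hr0 : r.eval 0 ≠ 0 := by
    rw [← Polynomial.coeff_zero_eq_eval_zero]
    have h1 : p.coeff k ≠ 0 := by
      rw [hk, ← Polynomial.trailingCoeff]
      exact Polynomial.trailingCoeff_nonzero_iff_nonzero.mpr hp0
    rw [hr, Polynomial.coeff_X_pow_mul'] at h1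
    simpa using h1
  have hlim1 : Tendsto (fun x : ℝ => C * x ^ (m - k)) (nhds 0) (nhds 0) := by
    have : Continuous fun x : ℝ => C * x ^ (m - k) := by fun_prop
    simpa [show m - k ≠ 0 by omega] using this.tendsto 0
  have hlim2 : Tendsto (fun x : ℝ => ‖r.eval (x : ℂ)‖) (nhds 0) (nhds ‖r.eval 0‖) := by
    have : Continuous fun x : ℝ => ‖r.eval (x : ℂ)‖ := by
      have := r.continuous
      fun_prop
    simpa using this.tendsto 0
  have hev := (hlim1.eventually_lt hlim2 (norm_pos_iff.mpr hr0)).filter_mono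
    (nhdsWithin_le_nhds (s := Set.Ioi (0 : ℝ)))
  filter_upwards [hev, self_mem_nhdsWithin] with x hx hx0
  have hx0' : (0 : ℝ) < x := hx0
  have hm : m = (m - k) + k := by omega
  rw [hr, Polynomial.eval_mul, norm_mul, Polynomial.eval_pow, Polynomial.eval_X, norm_pow,
    Complex.norm_real, Real.norm_of_nonneg hx0'.le]
  calc C * x ^ m = x ^ k * (C * x ^ (m - k)) := by
        conv_lhs => rw [hm, pow_add]
        ring
    _ < x ^ k * ‖r.eval (x : ℂ)‖ := by gcongr

/-! ### Unitarity of the layers -/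

theorem mul_mul_conjTranspose_eq_one {n : Type*} [Fintype n] [DecidableEq n] {A B : Matrix n n ℂ}
    (hA : A * Aᴴ = 1) (hB : B * Bᴴ = 1) : (A * B) * (A * B)ᴴ = 1 := by
  rw [Matrix.conjTranspose_mul, Matrix.mul_assoc, ← Matrix.mul_assoc B, hB, Matrix.one_mul, hA]

theorem siteLayer_conjTranspose {L : ℕ} [NeZero L] (A : Site L → Matrix (Fin 2) (Fin 2) ℂ) :
    (siteLayer A)ᴴ = siteLayer fun j => (A j)ᴴ := by
  ext x y
  simp [siteLayer, Matrix.conjTranspose_apply]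

theorem siteLayer_one {L : ℕ} [NeZero L] :
    siteLayer (fun _ : Site L => (1 : Matrix (Fin 2) (Fin 2) ℂ)) = 1 := by
  ext x y
  simp only [siteLayer, Matrix.of_apply, Matrix.one_apply]
  by_cases h : x = y
  · simp [h]
  · obtain ⟨j, hj⟩ := Function.ne_iff.mp h
    rw [if_neg h]
    exact Finset.prod_eq_zero (Finset.mem_univ j) (if_neg hj)

theorem siteLayer_smul {L : ℕ} [NeZero L] (c : Site L → ℂ)
    (A : Site L → Matrix (Fin 2) (Fin 2) ℂ) :
    siteLayer (fun j => c j • A j) = (∏ j, c j) • siteLayer A := by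
  ext x y
  simp [siteLayer, Finset.prod_mul_distrib]

/-! ### Regrouping the sites into the bonds of a layer -/

/-- The sites of the chain, grouped into the bonds of the layer `s`. -/
theorem bijective_bondSite (L : ℕ) [NeZero L] (s : ℕ) :
    Function.Bijective fun p : Fin L × Fin 2 => ((2 * (p.1 : ℕ) + s + p.2 : ℕ) : Site L) := by
  rw [Fintype.bijective_iff_injective_and_card]
  constructor
  · rintro ⟨i, a⟩ ⟨j, b⟩ h
    have h1 : ((2 * (i : ℕ) + a : ℕ) : Site L) = ((2 * (j : ℕ) + b : ℕ) : Site L) := by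
      have h2 : ((2 * (i : ℕ) + a : ℕ) : Site L) + s = ((2 * (j : ℕ) + b : ℕ) : Site L) + s := by
        push_cast at h ⊢
        linear_combination h
      exact add_right_cancel h2
    rw [ZMod.natCast_eq_natCast_iff, Nat.ModEq, Nat.mod_eq_of_lt (by omega),
      Nat.mod_eq_of_lt (by omega)] at h1
    ext
    · simp only; omega
    · simp only; omega
  · simp [ZMod.card, mul_comm]

def bondSite (L : ℕ) [NeZero L] (s : ℕ) : Fin L × Fin 2 ≃ Site L :=
  Equiv.ofBijective _ (bijective_bondSite L s)

/-- The tensor product over the bonds of the layer `s` of the two-qubit matrices `A i`. -/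
def bondOp {L : ℕ} [NeZero L] (s : ℕ) (A : Fin L → Matrix (Fin 2 × Fin 2) (Fin 2 × Fin 2) ℂ) :
    Op L :=
  Matrix.of fun x y => ∏ i : Fin L,
    A i (x (bondSite L s (i, 0)), x (bondSite L s (i, 1)))
      (y (bondSite L s (i, 0)), y (bondSite L s (i, 1)))

theorem bondLayer_eq_bondOp (L : ℕ) [NeZero L] (s : ℕ) :
    bondLayer L s = bondOp s fun _ => gate := by
  ext x y
  simp [bondLayer, bondOp, bondSite]

/-- The basis states, as families of basis states of the bonds. -/
def bondState (L : ℕ) [NeZero L] (s : ℕ) : (Fin L → Fin 2 × Fin 2) ≃ BasisState L where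
  toFun p j := if ((bondSite L s).symm j).2 = 0 then (p ((bondSite L s).symm j).1).1
    else (p ((bondSite L s).symm j).1).2
  invFun x i := (x (bondSite L s (i, 0)), x (bondSite L s (i, 1)))
  left_inv p := by ext i <;> simp
  right_inv x := by
    ext j
    obtain ⟨⟨i, a⟩, rfl⟩ := (bondSite L s).surjective j
    fin_cases a <;> simp

theorem bondOp_apply {L : ℕ} [NeZero L] {s : ℕ}
    (A : Fin L → Matrix (Fin 2 × Fin 2) (Fin 2 × Fin 2) ℂ) (x y : BasisState L) :
    bondOp s A x y = ∏ i, A i ((bondState L s).symm x i) ((bondState L s).symm y i) := rfl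

theorem bondOp_mul {L : ℕ} [NeZero L] (s : ℕ)
    (A B : Fin L → Matrix (Fin 2 × Fin 2) (Fin 2 × Fin 2) ℂ) :
    bondOp s A * bondOp s B = bondOp s fun i => A i * B i := by
  ext x y
  simp only [Matrix.mul_apply, bondOp_apply, ← Finset.prod_mul_distrib]
  rw [← (bondState L s).sum_comp]
  simp only [Equiv.symm_apply_apply]
  exact (Fintype.prod_sum fun i k => A i ((bondState L s).symm x i) k *
    B i k ((bondState L s).symm y i)).symm

theorem bondOp_conjTranspose {L : ℕ} [NeZero L] (s : ℕ)
    (A : Fin L → Matrix (Fin 2 × Fin 2) (Fin 2 × Fin 2) ℂ) :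
    (bondOp s A)ᴴ = bondOp s fun i => (A i)ᴴ := by
  ext x y
  simp [bondOp_apply, Matrix.conjTranspose_apply]

theorem bondOp_one {L : ℕ} [NeZero L] (s : ℕ) :
    bondOp s (fun _ : Fin L => 1) = 1 := by
  ext x y
  simp only [bondOp_apply, Matrix.one_apply]
  by_cases h : x = y
  · simp [h]
  · obtain ⟨i, hi⟩ := Function.ne_iff.mp ((bondState L s).symm.injective.ne h)
    rw [if_neg h]
    exact Finset.prod_eq_zero (Finset.mem_univ i) (if_neg hi)

theorem bondOp_smul {L : ℕ} [NeZero L] (s : ℕ) (c : Fin L → ℂ)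
    (A : Fin L → Matrix (Fin 2 × Fin 2) (Fin 2 × Fin 2) ℂ) :
    bondOp s (fun i => c i • A i) = (∏ i, c i) • bondOp s A := by
  ext x y
  simp [bondOp_apply, Finset.prod_mul_distrib]

theorem siteLayer_eq_bondOp {L : ℕ} [NeZero L] (s : ℕ)
    (A : Site L → Matrix (Fin 2) (Fin 2) ℂ) :
    siteLayer A = bondOp s fun i => A (bondSite L s (i, 0)) ⊗ₖ A (bondSite L s (i, 1)) := by
  ext x y
  simp only [siteLayer, bondOp, Matrix.of_apply, Matrix.kroneckerMap_apply]
  rw [← (bondSite L s).prod_comp, Fintype.prod_prod_type]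
  simp [Fin.prod_univ_two]

/-! ### Unitarity of the gate -/

theorem sqrt_two_inv_mul_self :
    (((Real.sqrt 2 : ℝ) : ℂ)⁻¹) * ((Real.sqrt 2 : ℝ) : ℂ)⁻¹ = 1 / 2 := by
  rw [← mul_inv, ← Complex.ofReal_mul, Real.mul_self_sqrt (by norm_num)]
  norm_num

theorem hadamard_conjTranspose : hadamardᴴ = hadamard := by
  ext i j
  fin_cases i <;> fin_cases j <;> simp [hadamard, Matrix.conjTranspose_apply]

theorem hadamard_mul_self : hadamard * hadamard = 1 := by
  rw [hadamard, Matrix.smul_mul, Matrix.mul_smul, smul_smul, sqrt_two_inv_mul_self,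
    Matrix.mul_fin_two]
  ext i j
  fin_cases i <;> fin_cases j <;> norm_num

theorem hadamard_mul_conjTranspose : hadamard * hadamardᴴ = 1 := by
  rw [hadamard_conjTranspose, hadamard_mul_self]

theorem iSWAP_mul_conjTranspose : iSWAP * iSWAPᴴ = 1 := by
  ext ⟨a, b⟩ ⟨c, d⟩
  fin_cases a <;> fin_cases b <;> fin_cases c <;> fin_cases d <;>
    simp [iSWAP, Matrix.mul_apply, Fintype.sum_prod_type, Fin.sum_univ_two]

theorem gate_mul_conjTranspose : gate * gateᴴ = 1 := by
  rw [gate, Matrix.conjTranspose_mul, Matrix.conjTranspose_kronecker, Matrix.mul_assoc,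
    ← Matrix.mul_assoc (hadamard ⊗ₖ hadamard), ← Matrix.mul_kronecker_mul,
    hadamard_mul_conjTranspose, Matrix.one_kronecker_one, Matrix.one_mul, iSWAP_mul_conjTranspose]

theorem bondLayer_mul_conjTranspose (L : ℕ) [NeZero L] (s : ℕ) :
    bondLayer L s * (bondLayer L s)ᴴ = 1 := by
  simp [bondLayer_eq_bondOp, bondOp_conjTranspose, bondOp_mul, gate_mul_conjTranspose, bondOp_one]

/-! ### One period with arbitrary matrices on the doped sites -/

/-- The doping layer `k` with arbitrary matrices on the doped sites. -/
def dopedSites {L : ℕ} (D : Finset (Site L)) (A : Fin 2 × {j // j ∈ D} → Matrix (Fin 2) (Fin 2) ℂ)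
    (k : Fin 2) (j : Site L) : Matrix (Fin 2) (Fin 2) ℂ :=
  if h : j ∈ D then A (k, ⟨j, h⟩) else 1

/-- The stage of one period with arbitrary matrices on the doped sites. -/
def periodOp {L : ℕ} [NeZero L] (D : Finset (Site L))
    (A : Fin 2 × {j // j ∈ D} → Matrix (Fin 2) (Fin 2) ℂ) : Op L :=
  siteLayer (dopedSites D A 1) * bondLayer L 1 * (siteLayer (dopedSites D A 0) * bondLayer L 0)

theorem dopingLayer_mul_conjTranspose {L : ℕ} [NeZero L] (D : Finset (Site L)) (V : Rotations D)
    (k : Fin 2) : dopingLayer D V k * (dopingLayer D V k)ᴴ = 1 := by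
  rw [dopingLayer, siteLayer_conjTranspose, siteLayer_mul, ← siteLayer_one]
  congr 1
  ext1 j
  split_ifs with h
  · exact Matrix.mem_unitaryGroup_iff.mp (V (k, ⟨j, h⟩)).2
  · simp

theorem floquetUnitary_mul_conjTranspose {L : ℕ} [NeZero L] (D : Finset (Site L))
    (V : Rotations D) : floquetUnitary D V * (floquetUnitary D V)ᴴ = 1 := by
  have h0 := mul_mul_conjTranspose_eq_one (dopingLayer_mul_conjTranspose D V 0)
    (bondLayer_mul_conjTranspose L 0)
  have h1 := mul_mul_conjTranspose_eq_one (dopingLayer_mul_conjTranspose D V 1)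
    (bondLayer_mul_conjTranspose L 1)
  exact mul_mul_conjTranspose_eq_one h1 h0

/-! ### The transfer matrix on Pauli strings -/

theorem trace_pauliString_mul {L : ℕ} [NeZero L] (μ ν : Site L → Fin 4) :
    (pauliString μ * pauliString ν).trace = if μ = ν then (2 : ℂ) ^ (2 * L) else 0 := by
  have h1 : ∀ a b : Fin 4, (pauli a * pauli b).trace = if a = b then (2 : ℂ) else 0 := by
    intro a b
    fin_cases a <;> fin_cases b <;>
      simp [pauli, Matrix.trace, Fin.sum_univ_two] <;> norm_num
  rw [pauliString, pauliString, siteLayer_mul, trace_siteLayer]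
  simp only [h1]
  split_ifs with h
  · subst h
    simp [ZMod.card]
  · obtain ⟨j, hj⟩ := Function.ne_iff.mp h
    exact Finset.prod_eq_zero (Finset.mem_univ j) (by simp [hj])

theorem pauliString_zero {L : ℕ} [NeZero L] : pauliString (0 : Site L → Fin 4) = 1 := by
  rw [← siteLayer_one]
  rfl

theorem weight_pos {L : ℕ} [NeZero L] {μ : Site L → Fin 4} (hμ : μ ≠ 0) : 0 < weight μ := by
  obtain ⟨j, hj⟩ := Function.ne_iff.mp hμ
  exact Finset.card_pos.mpr ⟨j, by simpa using hj⟩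

/-- The matrix of `A ↦ U A U†` in the basis of Pauli strings. -/
def pauliTransfer {L : ℕ} [NeZero L] (U : Op L) (μ ν : Site L → Fin 4) : ℂ :=
  ((2 : ℂ) ^ (2 * L))⁻¹ * (pauliString μ * (U * pauliString ν * Uᴴ)).trace

/-- The matrix of the channel on traceless operators in the basis of Pauli strings, as a
polynomial in the factor `exp (-γ)` of the noise. -/
def transferPoly {L : ℕ} [NeZero L] (U : Op L) :
    Matrix (Site L → Fin 4) (Site L → Fin 4) (Polynomial ℂ) :=
  Matrix.of fun μ ν =>
    if μ = 0 then 0 else Polynomial.C (pauliTransfer U μ ν) * Polynomial.X ^ weight μ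

/-- The value of `transferPoly` at the factor `x` of the noise. -/
def transferMatrix {L : ℕ} [NeZero L] (U : Op L) (x : ℂ) :
    Matrix (Site L → Fin 4) (Site L → Fin 4) ℂ :=
  (transferPoly U).map (Polynomial.eval x)

theorem transferMatrix_apply {L : ℕ} [NeZero L] (U : Op L) (x : ℂ) (μ ν : Site L → Fin 4) :
    transferMatrix U x μ ν = if μ = 0 then 0 else pauliTransfer U μ ν * x ^ weight μ := by
  simp only [transferMatrix, transferPoly, Matrix.map_apply, Matrix.of_apply]
  split_ifs <;> simp

theorem trace_transferMatrix_pow {L : ℕ} [NeZero L] (U : Op L) (x : ℂ) (n : ℕ) :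
    (transferMatrix U x ^ n).trace = ((transferPoly U ^ n).trace).eval x := by
  have h : transferMatrix U x = (Polynomial.evalRingHom x).mapMatrix (transferPoly U) := rfl
  rw [h, ← map_pow]
  exact (AddMonoidHom.map_trace (Polynomial.evalRingHom x) (transferPoly U ^ n)).symm

theorem noise_apply {L : ℕ} [NeZero L] (γ : ℝ) (A : Op L) :
    noise L γ A = ∑ μ : Site L → Fin 4,
      (((Real.exp (-γ) : ℝ) : ℂ) ^ weight μ * (((2 : ℂ) ^ (2 * L))⁻¹ *
        (pauliString μ * A).trace)) • pauliString μ := by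
  have hexp : ∀ w : ℕ, Real.exp (-γ * w) = Real.exp (-γ) ^ w := fun w => by
    rw [← Real.exp_nat_mul, mul_comm]
  simp only [noise, LinearMap.sum_apply, LinearMap.smul_apply, LinearMap.smulRight_apply,
    LinearMap.comp_apply, LinearMap.mulLeft_apply, Matrix.traceLinearMap_apply, smul_smul, hexp]
  refine Finset.sum_congr rfl fun μ _ => ?_
  congr 1
  push_cast
  ring

/-- Conjugation by a unitary preserves the trace, so the identity component evolves independently of
the others. This justifies discarding the row 0 in `transferPoly`. -/
theorem pauliTransfer_zero {L : ℕ} [NeZero L] {U : Op L} (hU : U * Uᴴ = 1)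
    (ν : Site L → Fin 4) : pauliTransfer U 0 ν = if ν = 0 then 1 else 0 := by
  have h2 : (U * pauliString ν * Uᴴ).trace = (pauliString 0 * pauliString ν).trace := by
    rw [Matrix.trace_mul_comm, ← Matrix.mul_assoc, mul_eq_one_comm.mp hU, pauliString_zero]
  rw [pauliTransfer, pauliString_zero, Matrix.one_mul, h2, trace_pauliString_mul]
  by_cases h : ν = 0
  · simp [h]
  · simp [h, Ne.symm h]

/-- The nonzero eigenvalues of the transfer matrix are eigenvalues of the channel. -/
theorem hasEigenvalue_floquetChannel {L : ℕ} [NeZero L] (D : Finset (Site L)) (V : Rotations D)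
    (γ : ℝ) {z : ℂ} (hz : z ≠ 0)
    (h : z ∈ spectrum ℂ (transferMatrix (floquetUnitary D V) (Real.exp (-γ) : ℝ))) :
    (floquetChannel D V γ).HasEigenvalue z := by
  set U := floquetUnitary D V with hUdef
  have hU : U * Uᴴ = 1 := floquetUnitary_mul_conjTranspose D V
  set x : ℂ := ((Real.exp (-γ) : ℝ) : ℂ) with hx
  rw [← Matrix.spectrum_toLin', ← Module.End.hasEigenvalue_iff_mem_spectrum] at h
  obtain ⟨v, hv⟩ := h.exists_hasEigenvector
  have hv1 : transferMatrix U x *ᵥ v = z • v := by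
    simpa using hv.apply_eq_smul
  have hv0 : v ≠ 0 := hv.2
  have hcoord : ∀ μ, ∑ ν, transferMatrix U x μ ν * v ν = z * v μ := fun μ => by
    simpa [Matrix.mulVec, dotProduct] using congrFun hv1 μ
  -- The row 0 of the transfer matrix vanishes, so an eigenvector for z ≠ 0 represents a traceless
  -- operator.
  have hvz : v 0 = 0 := by
    have := hcoord 0
    simp only [transferMatrix_apply, if_true, zero_mul, Finset.sum_const_zero] at this
    rcases mul_eq_zero.mp this.symm with h0 | h0
    · exact absurd h0 hz
    · exact h0
  set A : Op L := ∑ ν, v ν • pauliString ν with hA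
  have htrA : ∀ μ, (pauliString μ * A).trace = (2 : ℂ) ^ (2 * L) * v μ := by
    intro μ
    rw [hA, Finset.mul_sum, Matrix.trace_sum]
    simp [trace_pauliString_mul, mul_comm]
  have hA0 : A ≠ 0 := by
    intro h0
    apply hv0
    ext μ
    have := htrA μ
    rw [h0, Matrix.mul_zero, Matrix.trace_zero] at this
    simpa using this.symm
  have hR : ∀ μ, ((2 : ℂ) ^ (2 * L))⁻¹ * (pauliString μ * (U * A * Uᴴ)).trace =
      ∑ ν, pauliTransfer U μ ν * v ν := by
    intro μ
    simp only [hA, pauliTransfer, Finset.mul_sum, Finset.sum_mul, Matrix.trace_sum,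
      Matrix.mul_smul, Matrix.smul_mul, Matrix.trace_smul, smul_eq_mul]
    refine Finset.sum_congr rfl fun ν _ => ?_
    ring
  refine Module.End.hasEigenvalue_of_hasEigenvector (x := A)
    ⟨Module.End.mem_eigenspace_iff.mpr ?_, hA0⟩
  rw [floquetChannel, LinearMap.comp_apply, LinearMap.mulLeftRight_apply, ← hUdef, noise_apply,
    hA, Finset.smul_sum]
  refine Finset.sum_congr rfl fun μ _ => ?_
  rw [smul_smul, ← hA, hR]
  congr 1
  by_cases hμ : μ = 0
  · subst hμ
    simp [pauliTransfer_zero hU, hvz]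
  · rw [← hcoord μ, Finset.mul_sum]
    refine Finset.sum_congr rfl fun ν _ => ?_
    rw [transferMatrix_apply, if_neg hμ]
    ring

/-- The eigenvalues of the transfer matrix are of the order of the factor of the noise. -/
theorem norm_le_of_mem_spectrum_transferMatrix {L : ℕ} [NeZero L] (U : Op L) {x : ℝ}
    (hx0 : 0 ≤ x) (hx1 : x ≤ 1) {z : ℂ} (h : z ∈ spectrum ℂ (transferMatrix U x)) :
    ‖z‖ ≤ x * ∑ μ, ∑ ν, ‖pauliTransfer U μ ν‖ := by
  rw [← Matrix.spectrum_toLin', ← Module.End.hasEigenvalue_iff_mem_spectrum] at h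
  obtain ⟨v, hv⟩ := h.exists_hasEigenvector
  have hv1 : transferMatrix U x *ᵥ v = z • v := by
    simpa using hv.apply_eq_smul
  have hv0 : v ≠ 0 := hv.2
  have hcoord : ∀ μ, ∑ ν, transferMatrix U x μ ν * v ν = z * v μ := fun μ => by
    simpa [Matrix.mulVec, dotProduct] using congrFun hv1 μ
  have hS : 0 < ∑ μ, ‖v μ‖ := by
    obtain ⟨μ, hμ⟩ := Function.ne_iff.mp hv0
    exact Finset.sum_pos' (fun _ _ => norm_nonneg _) ⟨μ, Finset.mem_univ _, by simpa using hμ⟩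
  have hent : ∀ μ ν, ‖transferMatrix U x μ ν‖ ≤ x * ‖pauliTransfer U μ ν‖ := by
    intro μ ν
    rw [transferMatrix_apply]
    split_ifs with hμ
    · simpa using mul_nonneg hx0 (norm_nonneg _)
    · rw [norm_mul, norm_pow, Complex.norm_real, Real.norm_of_nonneg hx0, mul_comm]
      gcongr
      exact pow_le_of_le_one hx0 hx1 (weight_pos hμ).ne'
  refine le_of_mul_le_mul_right ?_ hS
  calc ‖z‖ * ∑ μ, ‖v μ‖ = ∑ μ, ‖∑ ν, transferMatrix U x μ ν * v ν‖ := by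
        simp only [hcoord, norm_mul, Finset.mul_sum]
    _ ≤ ∑ μ, ∑ ν, x * ‖pauliTransfer U μ ν‖ * ∑ κ, ‖v κ‖ := by
        refine Finset.sum_le_sum fun μ _ => (norm_sum_le _ _).trans ?_
        refine Finset.sum_le_sum fun ν _ => ?_
        rw [norm_mul]
        exact mul_le_mul (hent μ ν)
          (Finset.single_le_sum (f := fun κ => ‖v κ‖) (fun _ _ => norm_nonneg _)
            (Finset.mem_univ ν)) (norm_nonneg _) (mul_nonneg hx0 (norm_nonneg _))
    _ = _ := by simp only [← Finset.sum_mul, ← Finset.mul_sum]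

theorem liouvillianGap_le_of_hasEigenvalue {E : Type*} [AddCommGroup E] [Module ℂ E]
    [FiniteDimensional ℂ E] {Φ : Module.End ℂ E} {z : ℂ} {r : ℝ} (hz : Φ.HasEigenvalue z)
    (hz1 : z ≠ 1) (hr : Real.exp (-r) ≤ ‖z‖) : liouvillianGap Φ ≤ r := by
  have hz0 : z ≠ 0 := norm_pos_iff.mp ((Real.exp_pos _).trans_le hr)
  -- Boundedness is needed because `sSup` of an unbounded set of reals is 0; it holds since there
  -- are finitely many eigenvalues.
  have hbdd : BddAbove {r : ℝ | ∃ l : ℂ,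
      Φ.HasEigenvalue (Complex.exp l) ∧ Complex.exp l ≠ 1 ∧ l.re = r} := by
    refine (((Module.End.finite_hasEigenvalue (f := Φ)).image
      fun w => Real.log ‖w‖).bddAbove).mono ?_
    rintro _ ⟨l, hl, -, rfl⟩
    exact ⟨Complex.exp l, hl, by simp [Complex.norm_exp]⟩
  have hle := le_csSup hbdd ⟨Complex.log z, by rwa [Complex.exp_log hz0],
    by rwa [Complex.exp_log hz0], Complex.log_re z⟩
  have hlog : -r ≤ Real.log ‖z‖ := by
    rw [Real.le_log_iff_exp_le (norm_pos_iff.mpr hz0)]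
    exact hr
  rw [liouvillianGap]
  linarith

/-- A closed path of Pauli strings of mean weight below `3` with nonzero total amplitude bounds
the gap. -/
theorem eventually_liouvillianGap_le {L : ℕ} [NeZero L] (D : Finset (Site L)) (V : Rotations D)
    {n s : ℕ} (hn : 0 < n) (hs : s < 3 * n)
    (hc : ((transferPoly (floquetUnitary D V) ^ n).trace).coeff s ≠ 0) :
    ∀ᶠ γ : ℝ in atTop, liouvillianGap (floquetChannel D V γ) ≤ 3 * γ + 3 := by
  set U := floquetUnitary D V with hU
  set m : ℝ := (Fintype.card (Site L → Fin 4) : ℝ)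
  have hlim : Tendsto (fun γ : ℝ => Real.exp (-γ)) atTop (nhdsWithin 0 (Set.Ioi 0)) :=
    tendsto_nhdsWithin_iff.mpr ⟨Real.tendsto_exp_neg_atTop_nhds_zero,
      Eventually.of_forall fun γ => Real.exp_pos _⟩
  -- The factor is chosen so that factor * x ^ (3n), with x = exp (-γ), is m * exp (-(3γ + 3)) ^ n,
  -- the largest trace norm possible if every eigenvalue were at most exp (-(3γ + 3)) in norm.
  have h1 := hlim.eventually (eventually_lt_norm_eval hs hc (m * Real.exp (-3) ^ n))
  have h2 : ∀ᶠ γ : ℝ in atTop,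
      Real.exp (-γ) * ∑ μ, ∑ ν, ‖pauliTransfer U μ ν‖ < 1 := by
    have := Real.tendsto_exp_neg_atTop_nhds_zero.mul_const (∑ μ, ∑ ν, ‖pauliTransfer U μ ν‖)
    rw [zero_mul] at this
    exact this.eventually_lt_const one_pos
  filter_upwards [h1, h2, eventually_ge_atTop 0] with γ h1 h2 hγ
  obtain ⟨z, hz, hzn⟩ : ∃ z ∈ spectrum ℂ (transferMatrix U (Real.exp (-γ) : ℝ)),
      Real.exp (-(3 * γ + 3)) < ‖z‖ := by
    by_contra! hcon
    have h3 := norm_trace_pow_le _ hcon hn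
    rw [trace_transferMatrix_pow] at h3
    refine absurd (h1.trans_le h3) (lt_irrefl _ ∘ fun h => h.trans_eq ?_)
    rw [show -(3 * γ + 3) = -γ + -γ + -γ + -3 by ring, Real.exp_add, Real.exp_add, Real.exp_add]
    ring
  have hz0 : z ≠ 0 := norm_pos_iff.mp ((Real.exp_pos _).trans hzn)
  refine liouvillianGap_le_of_hasEigenvalue (hasEigenvalue_floquetChannel D V γ hz0 hz) ?_ hzn.le
  rintro rfl
  have := norm_le_of_mem_spectrum_transferMatrix U (Real.exp_pos (-γ)).le
    (by simpa using hγ) hz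
  rw [norm_one] at this
  linarith

/-! ### Amplitudes of closed paths as functions of the rotations -/

/-- The total amplitude of the closed paths of `n` nontrivial Pauli strings of total weight `s`. -/
def loopAmplitude {L : ℕ} [NeZero L] (D : Finset (Site L)) (n s : ℕ)
    (A : Fin 2 × {j // j ∈ D} → Matrix (Fin 2) (Fin 2) ℂ) : ℂ :=
  ((transferPoly (periodOp D A) ^ n).trace).coeff s

theorem exists_periodOp_smul {L : ℕ} [NeZero L] (D : Finset (Site L))
    (c : Fin 2 × {j // j ∈ D} → ℂ) :
    ∃ r : ℂ, ∀ A, periodOp D (fun i => c i • A i) = r • periodOp D A := by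
  let d : Fin 2 → Site L → ℂ := fun k j => if h : j ∈ D then c (k, ⟨j, h⟩) else 1
  have hd : ∀ A k, dopedSites D (fun i => c i • A i) k = fun j => d k j • dopedSites D A k j := by
    intro A k
    ext1 j
    simp only [dopedSites, d]
    split_ifs <;> simp
  refine ⟨(∏ j, d 1 j) * ∏ j, d 0 j, fun A => ?_⟩
  rw [periodOp, hd, hd, siteLayer_smul, siteLayer_smul, periodOp]
  simp only [Matrix.smul_mul, Matrix.mul_smul, smul_smul]
  rw [mul_comm]

theorem transferPoly_smul {L : ℕ} [NeZero L] (r : ℂ) (U : Op L) :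
    transferPoly (r • U) = Polynomial.C (r * star r) • transferPoly U := by
  ext1 μ ν
  simp only [transferPoly, pauliTransfer, Matrix.of_apply, Matrix.smul_apply, smul_eq_mul,
    Matrix.conjTranspose_smul, Matrix.smul_mul, Matrix.mul_smul, smul_smul, Matrix.trace_smul]
  split_ifs
  · simp
  · simp only [map_mul]
    ring

/-- The factor does not depend on A, so nonvanishing passes between unitaries and arbitrary
multiples of them. Quaternions need not be normalised, and they form a vector space on which
analyticity can be used. -/
theorem exists_loopAmplitude_smul {L : ℕ} [NeZero L] (D : Finset (Site L)) (n s : ℕ)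
    (c : Fin 2 × {j // j ∈ D} → ℂ) :
    ∃ r : ℂ, ∀ A, loopAmplitude D n s (fun i => c i • A i) = r * loopAmplitude D n s A := by
  obtain ⟨r, hr⟩ := exists_periodOp_smul D c
  refine ⟨(r * star r) ^ n, fun A => ?_⟩
  rw [loopAmplitude, hr, transferPoly_smul, smul_pow, Matrix.trace_smul, smul_eq_mul,
    ← Polynomial.C_pow, Polynomial.coeff_C_mul, loopAmplitude]

/-- The families of matrices on the doped sites, as a normed space. -/
abbrev DopingSpace {L : ℕ} (D : Finset (Site L)) : Type :=
  Fin 2 × {j // j ∈ D} → Fin 2 → Fin 2 → ℂ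

theorem analyticOnNhd_matrix_mul {E : Type*} [NormedAddCommGroup E] [NormedSpace ℝ E]
    {m : Type*} [Fintype m] {F G : E → Matrix m m ℂ}
    (hF : ∀ x y, AnalyticOnNhd ℝ (fun a => F a x y) Set.univ)
    (hG : ∀ x y, AnalyticOnNhd ℝ (fun a => G a x y) Set.univ) (x y : m) :
    AnalyticOnNhd ℝ (fun a => (F a * G a) x y) Set.univ := by
  simp only [Matrix.mul_apply]
  exact Finset.analyticOnNhd_fun_sum _ fun k _ => (hF x k).mul (hG k y)

theorem analyticOnNhd_star {E : Type*} [NormedAddCommGroup E] [NormedSpace ℝ E] {f : E → ℂ}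
    (hf : AnalyticOnNhd ℝ f Set.univ) : AnalyticOnNhd ℝ (fun a => star (f a)) Set.univ :=
  fun a ha => (Complex.conjCLE.toContinuousLinearMap.analyticAt (f a)).comp (hf a ha)

theorem analyticOnNhd_periodOp {L : ℕ} [NeZero L] (D : Finset (Site L)) (x y : BasisState L) :
    AnalyticOnNhd ℝ (fun A : DopingSpace D => periodOp D (fun i => Matrix.of (A i)) x y)
      Set.univ := by
  have hlayer : ∀ (k : Fin 2) (x y : BasisState L), AnalyticOnNhd ℝ (fun A : DopingSpace D =>
      siteLayer (dopedSites D (fun i => Matrix.of (A i)) k) x y) Set.univ := by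
    intro k x y
    simp only [siteLayer, Matrix.of_apply]
    refine Finset.analyticOnNhd_fun_prod _ fun j _ => ?_
    by_cases h : j ∈ D
    · simp only [dopedSites, h, dite_true, Matrix.of_apply]
      intro A _
      exact (((ContinuousLinearMap.proj (R := ℝ) (φ := fun _ : Fin 2 => ℂ) (y j)).comp
        (ContinuousLinearMap.proj (R := ℝ) (φ := fun _ : Fin 2 => Fin 2 → ℂ) (x j))).comp
        (ContinuousLinearMap.proj (R := ℝ)
          (φ := fun _ : Fin 2 × {j // j ∈ D} => Fin 2 → Fin 2 → ℂ) (k, ⟨j, h⟩))).analyticAt A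
    · simp only [dopedSites, h, dite_false]
      exact analyticOnNhd_const
  have hconst : ∀ (B : Op L) (x y : BasisState L),
      AnalyticOnNhd ℝ (fun _ : DopingSpace D => B x y) Set.univ := fun _ _ _ =>
    analyticOnNhd_const
  exact analyticOnNhd_matrix_mul (analyticOnNhd_matrix_mul (hlayer 1) (hconst _))
    (analyticOnNhd_matrix_mul (hlayer 0) (hconst _)) x y

theorem analyticOnNhd_loopAmplitude {L : ℕ} [NeZero L] (D : Finset (Site L)) (n s : ℕ) :
    AnalyticOnNhd ℝ (fun A : DopingSpace D => loopAmplitude D n s fun i => Matrix.of (A i))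
      Set.univ := by
  have hU := analyticOnNhd_periodOp D
  have hUs : ∀ x y, AnalyticOnNhd ℝ (fun A : DopingSpace D =>
      (periodOp D fun i => Matrix.of (A i))ᴴ x y) Set.univ := fun x y => by
    simpa only [Matrix.conjTranspose_apply] using analyticOnNhd_star (hU y x)
  have hconst : ∀ (B : Op L) (x y : BasisState L),
      AnalyticOnNhd ℝ (fun _ : DopingSpace D => B x y) Set.univ := fun _ _ _ =>
    analyticOnNhd_const
  have hR : ∀ μ ν, AnalyticOnNhd ℝ (fun A : DopingSpace D =>
      pauliTransfer (periodOp D fun i => Matrix.of (A i)) μ ν) Set.univ := by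
    intro μ ν
    simp only [pauliTransfer, Matrix.trace, Matrix.diag_apply]
    exact analyticOnNhd_const.mul (Finset.analyticOnNhd_fun_sum _ fun x _ =>
      analyticOnNhd_matrix_mul (hconst _)
        (analyticOnNhd_matrix_mul (analyticOnNhd_matrix_mul hU (hconst _)) hUs) x x)
  have hM : ∀ μ ν s, AnalyticOnNhd ℝ (fun A : DopingSpace D =>
      (transferPoly (periodOp D fun i => Matrix.of (A i)) μ ν).coeff s) Set.univ := by
    intro μ ν s
    simp only [transferPoly, Matrix.of_apply]
    by_cases hμ : μ = 0
    · simp only [hμ, if_true, Polynomial.coeff_zero]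
      exact analyticOnNhd_const
    · simp only [hμ, if_false, Polynomial.coeff_C_mul]
      exact (hR μ ν).mul analyticOnNhd_const
  have hpow : ∀ n μ ν s, AnalyticOnNhd ℝ (fun A : DopingSpace D =>
      ((transferPoly (periodOp D fun i => Matrix.of (A i)) ^ n) μ ν).coeff s) Set.univ := by
    intro n
    induction n with
    | zero =>
      intro μ ν s
      simp only [pow_zero]
      exact analyticOnNhd_const
    | succ n ih =>
      intro μ ν s
      simp only [pow_succ, Matrix.mul_apply, Polynomial.finsetSum_coeff, Polynomial.coeff_mul]
      exact Finset.analyticOnNhd_fun_sum _ fun κ _ => Finset.analyticOnNhd_fun_sum _ fun p _ =>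
        (ih μ κ p.1).mul (hM κ ν p.2)
  simp only [loopAmplitude, Matrix.trace, Matrix.diag_apply, Polynomial.finsetSum_coeff]
  exact Finset.analyticOnNhd_fun_sum _ fun μ _ => hpow n μ μ s

/-! ### Genericity of Haar rotations -/

/-- The quaternion `q 0 + i (q 1 X + q 2 Y + q 3 Z)`. -/
def quat (q : Fin 4 → ℝ) : Matrix (Fin 2) (Fin 2) ℂ :=
  !![(q 0 : ℂ) + Complex.I * q 3, (q 2 : ℂ) + Complex.I * q 1;
    -(q 2 : ℂ) + Complex.I * q 1, (q 0 : ℂ) - Complex.I * q 3]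

/-- A quaternion times its adjoint is its squared norm, so dividing by the norm makes it unitary. -/
theorem exists_quat_eq_smul (q : Fin 4 → ℝ) :
    ∃ (r : ℂ) (W : U2), quat q = r • (W : Matrix (Fin 2) (Fin 2) ℂ) := by
  by_cases hq : q = 0
  · refine ⟨0, 1, ?_⟩
    subst hq
    ext i j
    fin_cases i <;> fin_cases j <;> simp [quat]
  set N : ℝ := ∑ i, q i ^ 2 with hN
  have hNpos : 0 < N := by
    obtain ⟨i, hi⟩ := Function.ne_iff.mp hq
    exact Finset.sum_pos' (fun _ _ => sq_nonneg _)
      ⟨i, Finset.mem_univ _, by have : q i ≠ 0 := hi; positivity⟩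
  have hmul : quat q * (quat q)ᴴ = (N : ℂ) • 1 := by
    rw [hN, Fin.sum_univ_four]
    ext i j
    fin_cases i <;> fin_cases j <;>
      simp [quat, Matrix.mul_apply, Matrix.conjTranspose_apply, Fin.sum_univ_two] <;>
      ring_nf <;> simp [Complex.I_sq] <;> ring
  have hs : (((Real.sqrt N : ℝ) : ℂ)⁻¹) * ((Real.sqrt N : ℝ) : ℂ)⁻¹ * N = 1 := by
    rw [← mul_inv, ← Complex.ofReal_mul, Real.mul_self_sqrt hNpos.le]
    exact inv_mul_cancel₀ (by exact_mod_cast hNpos.ne')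
  refine ⟨(Real.sqrt N : ℝ), ⟨((Real.sqrt N : ℝ) : ℂ)⁻¹ • quat q, ?_⟩, ?_⟩
  · rw [Matrix.mem_unitaryGroup_iff, Matrix.star_eq_conjTranspose, Matrix.conjTranspose_smul,
      Matrix.smul_mul, Matrix.mul_smul, hmul, smul_smul, smul_smul]
    have : star (((Real.sqrt N : ℝ) : ℂ)⁻¹) = ((Real.sqrt N : ℝ) : ℂ)⁻¹ := by
      rw [star_inv₀]
      simp
    rw [this, hs, one_smul]
  · rw [smul_smul, mul_inv_cancel₀, one_smul]
    exact_mod_cast (Real.sqrt_pos.mpr hNpos).ne'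

/-- Dividing W by a square root of its determinant gives an element of SU(2), that is, a unit
quaternion. The relations between its entries come from comparing the adjugate with the adjoint. -/
theorem exists_eq_smul_quat (W : U2) :
    ∃ (z : ℂ) (q : Fin 4 → ℝ), (W : Matrix (Fin 2) (Fin 2) ℂ) = z • quat q := by
  set M : Matrix (Fin 2) (Fin 2) ℂ := W.1 with hM
  have hW : M * Mᴴ = 1 := Matrix.mem_unitaryGroup_iff.mp W.2
  set d := M.det with hd
  have hdn : ‖d‖ = 1 := by
    have h := congrArg Matrix.det hW
    rw [Matrix.det_mul, Matrix.det_conjTranspose, Matrix.det_one] at h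
    have h2 := congrArg norm h
    rw [norm_mul, norm_star, norm_one] at h2
    nlinarith [norm_nonneg d]
  have hadj : M.adjugate = d • Mᴴ := by
    calc M.adjugate = M.adjugate * (M * Mᴴ) := by rw [hW, Matrix.mul_one]
      _ = d • Mᴴ := by
        rw [← Matrix.mul_assoc, Matrix.adjugate_mul, Matrix.smul_mul, Matrix.one_mul]
  have h11 : M 1 1 = d * star (M 0 0) := by
    simpa [Matrix.adjugate_fin_two, Matrix.conjTranspose_apply] using congrFun₂ hadj 0 0
  have h10 : -M 1 0 = d * star (M 0 1) := by
    simpa [Matrix.adjugate_fin_two, Matrix.conjTranspose_apply] using congrFun₂ hadj 1 0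
  obtain ⟨y, hy⟩ := IsAlgClosed.exists_pow_nat_eq d (n := 2) (by norm_num)
  have hyn : ‖y‖ = 1 := by
    have h := congrArg norm hy
    rw [norm_pow, hdn] at h
    nlinarith [norm_nonneg y]
  have hyy : y * star y = 1 := by
    rw [Complex.star_def, Complex.mul_conj, Complex.normSq_eq_norm_sq, hyn]
    norm_num
  set α := star y * M 0 0 with hα
  set β := star y * M 0 1 with hβ
  have hre : ∀ w : ℂ, (w.re : ℂ) + Complex.I * w.im = w := fun w => by
    rw [mul_comm]
    exact Complex.re_add_im w
  have hre' : ∀ w : ℂ, (w.re : ℂ) - Complex.I * w.im = star w := fun w => by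
    apply Complex.ext <;> simp
  refine ⟨y, ![α.re, β.im, β.re, α.im], ?_⟩
  have hq : quat ![α.re, β.im, β.re, α.im] = !![α, β; -star β, star α] := by
    rw [← hre' β, ← hre' α, neg_sub]
    conv_rhs => rw [← hre α, ← hre β]
    simp [quat]
    ring_nf
  rw [hq]
  ext i j
  fin_cases i <;> fin_cases j
  · change M 0 0 = y * (star y * M 0 0)
    linear_combination -(M 0 0) * hyy
  · change M 0 1 = y * (star y * M 0 1)
    linear_combination -(M 0 1) * hyy
  · change M 1 0 = y * (-star (star y * M 0 1))
    rw [star_mul', star_star]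
    linear_combination -h10 + star (M 0 1) * hy
  · change M 1 1 = y * star (star y * M 0 0)
    rw [star_mul', star_star]
    linear_combination h11 - star (M 0 0) * hy

instance : haarU2.IsMulLeftInvariant := by
  unfold haarU2
  infer_instance

instance : SecondCountableTopology U2 :=
  inferInstanceAs (SecondCountableTopology {A : Fin 2 → Fin 2 → ℂ // A ∈ _})

instance {L : ℕ} (D : Finset (Site L)) : (haarRotations D).IsMulLeftInvariant := by
  unfold haarRotations
  infer_instance

instance {L : ℕ} (D : Finset (Site L)) : IsProbabilityMeasure (haarRotations D) := by
  unfold haarRotations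
  infer_instance

/-- An amplitude that is nonzero for some choice of the rotations is nonzero almost surely. -/
theorem ae_loopAmplitude_ne_zero {L : ℕ} [NeZero L] (D : Finset (Site L)) (n s : ℕ)
    (V₀ : Rotations D) (h₀ : loopAmplitude D n s (fun i => V₀ i) ≠ 0) :
    ∀ᵐ V ∂(haarRotations D), loopAmplitude D n s (fun i => V i) ≠ 0 := by
  let F : (Fin 2 × {j // j ∈ D} → Fin 4 → ℝ) → Rotations D → DopingSpace D :=
    fun q V i a b => (quat (q i) * (V i : Matrix (Fin 2) (Fin 2) ℂ)) a b
  let f : (Fin 2 × {j // j ∈ D} → Fin 4 → ℝ) → Rotations D → ℂ :=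
    fun q V => loopAmplitude D n s fun i => Matrix.of (F q V i)
  have hcoord : ∀ (i : Fin 2 × {j // j ∈ D}) (k : Fin 4), AnalyticOnNhd ℝ
      (fun q : Fin 2 × {j // j ∈ D} → Fin 4 → ℝ => ((q i k : ℝ) : ℂ)) Set.univ := by
    intro i k q _
    exact (Complex.ofRealCLM.comp
      ((ContinuousLinearMap.proj (R := ℝ) (φ := fun _ : Fin 4 => ℝ) k).comp
        (ContinuousLinearMap.proj (R := ℝ)
          (φ := fun _ : Fin 2 × {j // j ∈ D} => Fin 4 → ℝ) i))).analyticAt q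
  have hquat : ∀ (i : Fin 2 × {j // j ∈ D}) (a b : Fin 2), AnalyticOnNhd ℝ
      (fun q : Fin 2 × {j // j ∈ D} → Fin 4 → ℝ => quat (q i) a b) Set.univ := by
    intro i a b
    have hc : AnalyticOnNhd ℝ (fun _ : Fin 2 × {j // j ∈ D} → Fin 4 → ℝ => Complex.I) Set.univ :=
      analyticOnNhd_const
    fin_cases a <;> fin_cases b
    · exact (hcoord i 0).add (hc.mul (hcoord i 3))
    · exact (hcoord i 2).add (hc.mul (hcoord i 1))
    · exact (hcoord i 2).neg.add (hc.mul (hcoord i 1))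
    · exact (hcoord i 0).sub (hc.mul (hcoord i 3))
  have hanalytic : ∀ V, AnalyticOnNhd ℝ (fun q => f q V) Set.univ := by
    intro V
    have hF : AnalyticOnNhd ℝ (fun q => F q V) Set.univ := by
      refine AnalyticOnNhd.pi fun i => AnalyticOnNhd.pi fun a => AnalyticOnNhd.pi fun b => ?_
      simp only [Matrix.mul_apply]
      exact Finset.analyticOnNhd_fun_sum _ fun k _ => (hquat i a k).mul analyticOnNhd_const
    exact fun q _ => AnalyticAt.fun_comp (f := fun q => F q V)
      (analyticOnNhd_loopAmplitude D n s (F q V) trivial) (hF q trivial)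
  have hcont : Continuous fun p : (Fin 2 × {j // j ∈ D} → Fin 4 → ℝ) × Rotations D =>
      f p.1 p.2 := by
    have h1 : Continuous fun A : DopingSpace D =>
        loopAmplitude D n s fun i => Matrix.of (A i) := by
      rw [← continuousOn_univ]
      exact (analyticOnNhd_loopAmplitude D n s).continuousOn
    refine h1.comp (continuous_pi fun i => continuous_pi fun a => continuous_pi fun b => ?_)
    simp only [F, Matrix.mul_apply]
    refine continuous_finsetSum _ fun k _ => Continuous.mul ?_ ?_
    · exact (continuousOn_univ.mp (hquat i a k).continuousOn).comp continuous_fst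
    · exact (continuous_subtype_val.comp
        ((continuous_apply i).comp continuous_snd)).matrix_elem k b
  -- For given V, left multiplication by the quaternion of V₀ V⁻¹ leads to V₀ up to scalars, where
  -- the amplitude is nonzero.
  have hex : ∀ V, ∃ q, f q V ≠ 0 := by
    intro V
    choose z q hzq using fun i => exists_eq_smul_quat (V₀ i * (V i)⁻¹)
    obtain ⟨r, hr⟩ := exists_loopAmplitude_smul D n s z
    refine ⟨q, fun h => h₀ ?_⟩
    have hV : (fun i => (V₀ i : Matrix (Fin 2) (Fin 2) ℂ)) =
        fun i => z i • (quat (q i) * (V i : Matrix (Fin 2) (Fin 2) ℂ)) := by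
      ext1 i
      rw [← Matrix.smul_mul, ← hzq i, ← Submonoid.coe_mul]
      simp
    rw [hV, hr]
    exact mul_eq_zero_of_right r h
  have hae : ∀ᵐ q : Fin 2 × {j // j ∈ D} → Fin 4 → ℝ, ∀ᵐ V ∂(haarRotations D), f q V ≠ 0 := by
    rw [Measure.ae_ae_comm (p := fun q V => f q V ≠ 0)]
    · refine Eventually.of_forall fun V => ?_
      obtain ⟨q, hq⟩ := hex V
      exact ae_ne_zero_of_analyticOnNhd volume (hanalytic V) hq
    · exact (isOpen_ne_fun hcont continuous_const).measurableSet
  -- One good q is a multiple of a fixed family W of unitaries; left invariance of the Haar measure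
  -- removes W.
  obtain ⟨q, hq⟩ := hae.exists
  choose r W hrW using fun i => exists_quat_eq_smul (q i)
  obtain ⟨t, ht⟩ := exists_loopAmplitude_smul D n s r
  have hW : ∀ᵐ V ∂(haarRotations D), loopAmplitude D n s (fun i => ((W * V) i : U2)) ≠ 0 := by
    filter_upwards [hq] with V hV h
    apply hV
    have hVe : (fun i => Matrix.of (F q V i)) =
        fun i => r i • (((W * V) i : U2) : Matrix (Fin 2) (Fin 2) ℂ) := by
      ext1 i
      simp only [F, hrW, Pi.mul_apply, Submonoid.coe_mul, Matrix.smul_mul]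
      rfl
    simp only [f]
    rw [hVe, ht, h, mul_zero]
  exact (eventually_mul_left_iff (haarRotations D) W
    (p := fun V => loopAmplitude D n s (fun i => (V i : Matrix (Fin 2) (Fin 2) ℂ)) ≠ 0)).mp hW

/-! ### Clifford operations -/

/-- `V` maps Pauli matrices to Pauli matrices up to signs, according to `τ`. -/
def IsSiteClifford (V : Matrix (Fin 2) (Fin 2) ℂ) (τ : Fin 4 → Fin 4) : Prop :=
  ∀ a, ∃ c : ℂ, c ^ 2 = 1 ∧ V * pauli a = c • (pauli (τ a) * V)

/-- `U` maps Pauli strings to Pauli strings up to signs, according to `σ`. -/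
def IsClifford {L : ℕ} [NeZero L] (U : Op L) (σ : (Site L → Fin 4) → Site L → Fin 4) : Prop :=
  ∀ μ, ∃ c : ℂ, c ^ 2 = 1 ∧ U * pauliString μ = c • (pauliString (σ μ) * U)

theorem IsSiteClifford.mul {V W : Matrix (Fin 2) (Fin 2) ℂ} {τ ρ : Fin 4 → Fin 4}
    (hV : IsSiteClifford V τ) (hW : IsSiteClifford W ρ) :
    IsSiteClifford (V * W) (fun a => τ (ρ a)) := by
  intro a
  obtain ⟨c, hc, h1⟩ := hW a
  obtain ⟨d, hd, h2⟩ := hV (ρ a)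
  refine ⟨c * d, by rw [mul_pow, hc, hd, one_mul], ?_⟩
  rw [Matrix.mul_assoc, h1, Matrix.mul_smul, ← Matrix.mul_assoc, h2, Matrix.smul_mul, smul_smul,
    Matrix.mul_assoc]

theorem IsClifford.mul {L : ℕ} [NeZero L] {U W : Op L}
    {σ ρ : (Site L → Fin 4) → Site L → Fin 4} (hU : IsClifford U σ) (hW : IsClifford W ρ) :
    IsClifford (U * W) (fun μ => σ (ρ μ)) := by
  intro a
  obtain ⟨c, hc, h1⟩ := hW a
  obtain ⟨d, hd, h2⟩ := hU (ρ a)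
  refine ⟨c * d, by rw [mul_pow, hc, hd, one_mul], ?_⟩
  rw [Matrix.mul_assoc, h1, Matrix.mul_smul, ← Matrix.mul_assoc, h2, Matrix.smul_mul, smul_smul,
    Matrix.mul_assoc]

theorem isSiteClifford_one : IsSiteClifford 1 id := fun a => ⟨1, by simp⟩

theorem isSiteClifford_hadamard : IsSiteClifford hadamard ![0, 3, 2, 1] := by
  intro a
  refine ⟨![1, 1, -1, 1] a, by fin_cases a <;> simp, ?_⟩
  fin_cases a <;> ext i j <;> fin_cases i <;> fin_cases j <;>
    simp [hadamard, pauli, Matrix.mul_apply, Fin.sum_univ_two] <;> ring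

/-- The phase gate. -/
def phaseGate : Matrix (Fin 2) (Fin 2) ℂ := !![1, 0; 0, Complex.I]

theorem isSiteClifford_phaseGate : IsSiteClifford phaseGate ![0, 2, 1, 3] := by
  intro a
  refine ⟨![1, 1, -1, 1] a, by fin_cases a <;> simp, ?_⟩
  fin_cases a <;> ext i j <;> fin_cases i <;> fin_cases j <;>
    simp [phaseGate, pauli, Matrix.mul_apply, Fin.sum_univ_two]

theorem hadamard_mem : hadamard ∈ Matrix.unitaryGroup (Fin 2) ℂ :=
  Matrix.mem_unitaryGroup_iff.mpr hadamard_mul_conjTranspose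

theorem phaseGate_mem : phaseGate ∈ Matrix.unitaryGroup (Fin 2) ℂ := by
  rw [Matrix.mem_unitaryGroup_iff]
  ext i j
  fin_cases i <;> fin_cases j <;> simp [phaseGate, Matrix.mul_apply, Fin.sum_univ_two]

/-- The left factor of the image of `σ_a ⊗ σ_b` under the gate, up to a sign. -/
def gateMap (a b : Fin 4) : Fin 4 :=
  (![![0, 3, 1, 2], ![0, 3, 1, 2], ![3, 0, 2, 1], ![3, 0, 2, 1]] : Fin 4 → Fin 4 → Fin 4) a b

theorem iSWAP_mul_apply (M : Matrix (Fin 2 × Fin 2) (Fin 2 × Fin 2) ℂ) (p q : Fin 2 × Fin 2) :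
    (iSWAP * M) p q = (if p.1 = p.2 then 1 else Complex.I) * M (p.2, p.1) q := by
  rw [Matrix.mul_apply, Finset.sum_eq_single (p.2, p.1)]
  · simp [iSWAP]
  · intro r _ hr
    have : ¬p = (r.2, r.1) := fun h => hr (by rw [h])
    simp [iSWAP, this]
  · simp

theorem mul_iSWAP_apply (M : Matrix (Fin 2 × Fin 2) (Fin 2 × Fin 2) ℂ) (p q : Fin 2 × Fin 2) :
    (M * iSWAP) p q = M p (q.2, q.1) * (if q.1 = q.2 then 1 else Complex.I) := by
  rw [Matrix.mul_apply, Finset.sum_eq_single (q.2, q.1)]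
  · simp [iSWAP, eq_comm]
  · intro r _ hr
    simp [iSWAP, hr]
  · simp

set_option maxHeartbeats 2000000 in
-- The relabelling `![0, 3, 2, 1]` is the action of the Hadamard gates that precede `iSWAP` in
-- `gate`. As `iSWAP` is symmetric in its two qubits, the same table with swapped arguments gives
-- the second factor.
theorem iSWAP_mul_pauli (a b : Fin 4) : ∃ c : ℂ, c ^ 2 = 1 ∧
    iSWAP * (pauli (![0, 3, 2, 1] a) ⊗ₖ pauli (![0, 3, 2, 1] b)) =
      c • ((pauli (gateMap a b) ⊗ₖ pauli (gateMap b a)) * iSWAP) := by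
  refine ⟨(![![1, 1, -1, 1], ![1, 1, -1, 1], ![-1, -1, 1, 1], ![1, 1, 1, 1]] :
    Fin 4 → Fin 4 → ℂ) a b, by fin_cases a <;> fin_cases b <;> simp, ?_⟩
  ext ⟨i, j⟩ ⟨k, l⟩
  rw [iSWAP_mul_apply, Matrix.smul_apply, mul_iSWAP_apply]
  fin_cases a <;> fin_cases b <;>
    fin_cases i <;> fin_cases j <;> fin_cases k <;> fin_cases l <;>
    simp [gateMap, pauli]

theorem gate_mul_pauli (a b : Fin 4) : ∃ c : ℂ, c ^ 2 = 1 ∧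
    gate * (pauli a ⊗ₖ pauli b) = c • ((pauli (gateMap a b) ⊗ₖ pauli (gateMap b a)) * gate) := by
  obtain ⟨c, hc, h⟩ := iSWAP_mul_pauli a b
  obtain ⟨d, hd, ha⟩ := isSiteClifford_hadamard a
  obtain ⟨e, he, hb⟩ := isSiteClifford_hadamard b
  refine ⟨d * e * c, by rw [mul_pow, mul_pow, hc, hd, he]; norm_num, ?_⟩
  rw [gate, Matrix.mul_assoc, ← Matrix.mul_kronecker_mul, ha, hb, Matrix.smul_kronecker,
    Matrix.kronecker_smul, Matrix.mul_kronecker_mul, smul_smul, Matrix.mul_smul,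
    ← Matrix.mul_assoc, h, Matrix.smul_mul, smul_smul, Matrix.mul_assoc]

/-- The parity of a site. -/
def parity (L : ℕ) : Site L →+* ZMod 2 := ZMod.castHom (dvd_mul_right 2 L) (ZMod 2)

/-- The other site of the bond of the layer `s` through the site `j`. -/
def partner {L : ℕ} (s : ℕ) (j : Site L) : Site L := if parity L j = s then j + 1 else j - 1

/-- The image of a Pauli string under the layer `s` of gates, up to a sign. -/
def bondMap {L : ℕ} (s : ℕ) (μ : Site L → Fin 4) (j : Site L) : Fin 4 :=
  gateMap (μ j) (μ (partner s j))

theorem partner_bondSite_zero {L : ℕ} [NeZero L] (s : ℕ) (i : Fin L) :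
    partner s (bondSite L s (i, 0)) = bondSite L s (i, 1) := by
  have h2 : parity L 2 = 0 := by rw [map_ofNat]; rfl
  have h : parity L (bondSite L s (i, 0)) = s := by
    simp [bondSite, h2]
  rw [partner, if_pos h]
  simp [bondSite]

theorem partner_bondSite_one {L : ℕ} [NeZero L] (s : ℕ) (i : Fin L) :
    partner s (bondSite L s (i, 1)) = bondSite L s (i, 0) := by
  have h2 : parity L 2 = 0 := by rw [map_ofNat]; rfl
  have h : parity L (bondSite L s (i, 1)) ≠ s := by
    simp [bondSite, h2]
  rw [partner, if_neg h]
  simp [bondSite]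

theorem isClifford_bondLayer {L : ℕ} [NeZero L] (s : ℕ) :
    IsClifford (bondLayer L s) (bondMap s) := by
  intro μ
  choose c hc h using gate_mul_pauli
  refine ⟨∏ i : Fin L, c (μ (bondSite L s (i, 0))) (μ (bondSite L s (i, 1))), ?_, ?_⟩
  · simp [← Finset.prod_pow, hc]
  · rw [bondLayer_eq_bondOp, pauliString, siteLayer_eq_bondOp s, bondOp_mul, pauliString,
      siteLayer_eq_bondOp s, bondOp_mul, ← bondOp_smul]
    simp only [h, bondMap, partner_bondSite_zero, partner_bondSite_one]

theorem isClifford_siteLayer {L : ℕ} [NeZero L] {A : Site L → Matrix (Fin 2) (Fin 2) ℂ}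
    {τ : Site L → Fin 4 → Fin 4} (hA : ∀ j, IsSiteClifford (A j) (τ j)) :
    IsClifford (siteLayer A) (fun μ j => τ j (μ j)) := by
  intro μ
  choose c hc h using fun j => hA j (μ j)
  refine ⟨∏ j, c j, by simp [← Finset.prod_pow, hc], ?_⟩
  rw [pauliString, siteLayer_mul, pauliString, siteLayer_mul, ← siteLayer_smul]
  simp only [h]

/-! ### Transfer matrices of Clifford circuits and their closed orbits -/

theorem IsClifford.pauliTransfer_eq {L : ℕ} [NeZero L] {U : Op L}
    {σ : (Site L → Fin 4) → Site L → Fin 4} (hσ : IsClifford U σ) (hU : U * Uᴴ = 1)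
    (ν : Site L → Fin 4) : ∃ c : ℂ, c ^ 2 = 1 ∧
      ∀ μ, pauliTransfer U μ ν = if μ = σ ν then c else 0 := by
  obtain ⟨c, hc, h⟩ := hσ ν
  refine ⟨c, hc, fun μ => ?_⟩
  rw [pauliTransfer, h, Matrix.smul_mul, Matrix.mul_assoc, hU, Matrix.mul_one, Matrix.mul_smul,
    Matrix.trace_smul, trace_pauliString_mul]
  split_ifs
  · rw [smul_eq_mul, mul_left_comm, inv_mul_cancel₀ (pow_ne_zero _ two_ne_zero), mul_one]
  · simp

/-- Distinct Pauli strings are trace-orthogonal and conjugation preserves this, whereas two strings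
with a common image would have proportional, hence non-orthogonal, images. -/
theorem IsClifford.injective {L : ℕ} [NeZero L] {U : Op L}
    {σ : (Site L → Fin 4) → Site L → Fin 4} (hσ : IsClifford U σ) (hU : U * Uᴴ = 1) :
    Function.Injective σ := by
  have hconj : ∀ μ, ∃ c : ℂ, c ^ 2 = 1 ∧ U * pauliString μ * Uᴴ = c • pauliString (σ μ) := by
    intro μ
    obtain ⟨c, hc, h⟩ := hσ μ
    exact ⟨c, hc, by rw [h, Matrix.smul_mul, Matrix.mul_assoc, hU, Matrix.mul_one]⟩
  intro μ ν h
  by_contra hne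
  obtain ⟨c, hc, h1⟩ := hconj μ
  obtain ⟨d, hd, h2⟩ := hconj ν
  have hc0 : c ≠ 0 := by
    rintro rfl
    simp at hc
  have hd0 : d ≠ 0 := by
    rintro rfl
    simp at hd
  have h3 : ((U * pauliString μ * Uᴴ) * (U * pauliString ν * Uᴴ)).trace = 0 := by
    rw [show (U * pauliString μ * Uᴴ) * (U * pauliString ν * Uᴴ) =
      U * (pauliString μ * (Uᴴ * U) * pauliString ν) * Uᴴ by simp only [Matrix.mul_assoc],
      Matrix.trace_mul_comm, ← Matrix.mul_assoc, mul_eq_one_comm.mp hU, Matrix.one_mul,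
      Matrix.mul_one, trace_pauliString_mul, if_neg hne]
  rw [h1, h2, h, Matrix.smul_mul, Matrix.mul_smul, smul_smul, Matrix.trace_smul,
    trace_pauliString_mul, if_pos rfl, smul_eq_mul] at h3
  simp [hc0, hd0] at h3

theorem IsClifford.map_zero {L : ℕ} [NeZero L] {U : Op L}
    {σ : (Site L → Fin 4) → Site L → Fin 4} (hσ : IsClifford U σ) (hU : U * Uᴴ = 1) :
    σ 0 = 0 := by
  obtain ⟨c, -, h⟩ := hσ.pauliTransfer_eq hU 0
  by_contra hne
  have := h 0
  rw [pauliTransfer_zero hU, if_pos rfl, if_neg (Ne.symm hne)] at this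
  exact one_ne_zero this

/-- The total weight of the images of `μ` under the first `k` iterates of `σ`. -/
def orbitWeight {L : ℕ} [NeZero L] (σ : (Site L → Fin 4) → Site L → Fin 4) (k : ℕ)
    (μ : Site L → Fin 4) : ℕ :=
  ∑ t ∈ Finset.range k, weight (σ^[t + 1] μ)

/-- Only one path starts at ν, namely its orbit. It never meets the removed row 0, since σ is
injective and fixes 0. -/
theorem IsClifford.transferPoly_pow {L : ℕ} [NeZero L] {U : Op L}
    {σ : (Site L → Fin 4) → Site L → Fin 4} (hσ : IsClifford U σ) (hU : U * Uᴴ = 1) (k : ℕ) :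
    ∀ ν ≠ 0, ∃ c : ℂ, c ^ 2 = 1 ∧ ∀ μ, (transferPoly U ^ k) μ ν =
      if μ = σ^[k] ν then Polynomial.C c * Polynomial.X ^ orbitWeight σ k ν else 0 := by
  induction k with
  | zero =>
    intro ν _
    exact ⟨1, by simp, fun μ => by simp [Matrix.one_apply, orbitWeight]⟩
  | succ k ih =>
    intro ν hν
    have hσν : σ ν ≠ 0 := fun h => hν (hσ.injective hU (h.trans (hσ.map_zero hU).symm))
    obtain ⟨c, hc, h1⟩ := ih (σ ν) hσν
    obtain ⟨d, hd, h2⟩ := hσ.pauliTransfer_eq hU ν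
    refine ⟨c * d, by rw [mul_pow, hc, hd, one_mul], fun μ => ?_⟩
    have hw : orbitWeight σ (k + 1) ν = orbitWeight σ k (σ ν) + weight (σ ν) := by
      simp only [orbitWeight]
      rw [Finset.sum_range_succ']
      simp [Function.iterate_succ_apply]
    rw [pow_succ, Matrix.mul_apply, Finset.sum_eq_single (σ ν), h1, Function.iterate_succ_apply]
    · simp only [transferPoly, Matrix.of_apply, hσν, if_false, h2, if_true]
      split_ifs
      · rw [hw, pow_add, Polynomial.C_mul]
        ring
      · rw [zero_mul]
    · intro κ _ hκ
      simp [transferPoly, h2, hκ]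
    · simp

theorem IsClifford.transferPoly_pow_zero {L : ℕ} [NeZero L] {U : Op L}
    {σ : (Site L → Fin 4) → Site L → Fin 4} (hσ : IsClifford U σ) (hU : U * Uᴴ = 1) {k : ℕ}
    (hk : 0 < k) (μ : Site L → Fin 4) : (transferPoly U ^ k) μ 0 = 0 := by
  obtain ⟨k, rfl⟩ := Nat.exists_eq_add_one.mpr hk
  obtain ⟨d, hd, h2⟩ := hσ.pauliTransfer_eq hU 0
  rw [pow_succ, Matrix.mul_apply]
  refine Finset.sum_eq_zero fun κ _ => ?_
  by_cases hκ : κ = 0 <;> simp [transferPoly, h2, hκ, hσ.map_zero hU]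

/-- A Clifford circuit has a positive amplitude for closed paths along each of its orbits. -/
theorem IsClifford.exists_coeff_trace_ne_zero {L : ℕ} [NeZero L] {U : Op L}
    {σ : (Site L → Fin 4) → Site L → Fin 4} (hσ : IsClifford U σ) (hU : U * Uᴴ = 1)
    {μ₀ : Site L → Fin 4} (hμ₀ : μ₀ ≠ 0) (hlight : weight μ₀ < 3)
    (horbit : ∀ t, weight (σ^[t] μ₀) ≤ 3) :
    ∃ n s : ℕ, 0 < n ∧ s < 3 * n ∧ ((transferPoly U ^ n).trace).coeff s ≠ 0 := by
  obtain ⟨p, hp, hσp⟩ : ∃ p, 0 < p ∧ σ^[p] = id := by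
    let e := Equiv.ofBijective σ (Finite.injective_iff_bijective.mp (hσ.injective hU))
    refine ⟨orderOf e, orderOf_pos e, ?_⟩
    have h := Equiv.Perm.iterate_eq_pow e (orderOf e)
    rw [pow_orderOf_eq_one] at h
    exact h
  -- Running through the period p twice squares every sign to 1, so the diagonal entries are
  -- monomials with coefficient 1 and cannot cancel.
  have hdiag : ∀ ν, ((transferPoly U ^ (p + p)) ν ν) =
      if ν = 0 then 0 else Polynomial.X ^ (orbitWeight σ p ν + orbitWeight σ p ν) := by
    intro ν
    split_ifs with hν
    · rw [hν]
      exact hσ.transferPoly_pow_zero hU (by omega) 0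
    · obtain ⟨c, hc, h⟩ := hσ.transferPoly_pow hU p ν hν
      simp only [hσp, id] at h
      rw [pow_add, Matrix.mul_apply, Finset.sum_eq_single ν]
      · rw [h ν, if_pos rfl, pow_add, mul_mul_mul_comm, ← Polynomial.C_mul, ← pow_two c, hc,
          Polynomial.C_1, one_mul]
      · intro κ _ hκ
        rw [h κ, if_neg hκ, mul_zero]
      · simp
  refine ⟨p + p, orbitWeight σ p μ₀ + orbitWeight σ p μ₀, by omega, ?_, ?_⟩
  · have hlt : orbitWeight σ p μ₀ < ∑ t ∈ Finset.range p, 3 := by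
      -- `orbitWeight` counts the times 1, ..., p, so the light string μ₀ itself is met at the last
      -- one, t = p - 1.
      refine Finset.sum_lt_sum (fun t _ => horbit _)
        ⟨p - 1, Finset.mem_range.mpr (by omega), ?_⟩
      rwa [Nat.sub_add_cancel hp, hσp]
    simp at hlt
    omega
  · simp only [Matrix.trace, Matrix.diag_apply, Polynomial.finsetSum_coeff, hdiag]
    have hcoeff : ∀ ν : Site L → Fin 4, (if ν = 0 then (0 : Polynomial ℂ) else
        Polynomial.X ^ (orbitWeight σ p ν + orbitWeight σ p ν)).coeff
          (orbitWeight σ p μ₀ + orbitWeight σ p μ₀) =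
        if ν ≠ 0 ∧ orbitWeight σ p μ₀ = orbitWeight σ p ν then 1 else 0 := by
      intro ν
      by_cases hν : ν = 0
      · simp [hν]
      · simp only [hν, if_false, Polynomial.coeff_X_pow, ne_eq, not_false_eq_true, true_and]
        exact if_congr (by omega) rfl rfl
    simp only [hcoeff, Finset.sum_boole]
    exact Nat.cast_ne_zero.mpr (Finset.card_ne_zero.mpr ⟨μ₀, by simp [hμ₀]⟩)

/-! ### A chiral soliton of a densely doped Clifford circuit

The soliton moves by `ε = ± 1` in each layer; in the layer `k` its front is on a site of parity
`k + η`. -/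

/-- The direction `ε` of motion and the parity `η` of the sites from which the gates of the layer
`0` move in this direction. -/
def IsChirality {L : ℕ} (ε : Site L) (η : ZMod 2) : Prop := (ε = 1 ∧ η = 0) ∨ (ε = -1 ∧ η = 1)

/-- Reversing the direction exchanges the two sublattices, so one formula serves both chiralities.
-/
theorem IsChirality.partner_eq {L : ℕ} {ε : Site L} {η : ZMod 2} (h : IsChirality ε η) (k : ℕ)
    (j : Site L) : partner k j = if parity L j = k + η then j + ε else j - ε := by
  have hZ : ∀ a b : ZMod 2, a = b + 1 ↔ ¬a = b := by decide
  rcases h with ⟨rfl, rfl⟩ | ⟨rfl, rfl⟩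
  · simp [partner]
  · simp only [partner, hZ, ite_not]
    split_ifs <;> ring

theorem IsChirality.parity_add {L : ℕ} {ε : Site L} {η : ZMod 2} (h : IsChirality ε η)
    (j : Site L) : parity L (j + ε) = parity L j + 1 := by
  rcases h with ⟨rfl, rfl⟩ | ⟨rfl, rfl⟩
  · simp
  · rw [map_add, map_neg, map_one]
    rfl

theorem IsChirality.parity_sub {L : ℕ} {ε : Site L} {η : ZMod 2} (h : IsChirality ε η)
    (j : Site L) : parity L (j - ε) = parity L j + 1 := by
  have h1 := h.parity_add (j - ε)
  rw [sub_add_cancel] at h1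
  rw [h1, add_assoc]
  exact (add_zero _).symm

/-- The action on Pauli matrices of the rotation of the layer `k` at the site `j`, up to signs,
for a circuit doped on `D`. -/
def rotationMap {L : ℕ} (D : Finset (Site L)) (ε : Site L) (η : ZMod 2) (k : ℕ) (j : Site L) :
    Fin 4 → Fin 4 :=
  if j ∈ D then
    if parity L j = k + η then ![0, 3, 2, 1]
    else if j - ε ∈ D then (if j + ε ∈ D then ![0, 2, 3, 1] else ![0, 2, 1, 3])
    else if j + ε ∈ D then ![0, 1, 3, 2] else ![0, 3, 1, 2]
  else id

theorem exists_isSiteClifford_rotationMap {L : ℕ} (D : Finset (Site L)) (ε : Site L) (η : ZMod 2)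
    (k : ℕ) (j : Site L) :
    ∃ V : U2, IsSiteClifford (V : Matrix (Fin 2) (Fin 2) ℂ) (rotationMap D ε η k j) := by
  have hH := isSiteClifford_hadamard
  have hS := isSiteClifford_phaseGate
  let H : U2 := ⟨hadamard, hadamard_mem⟩
  let S : U2 := ⟨phaseGate, phaseGate_mem⟩
  rw [rotationMap]
  split_ifs
  · exact ⟨H, hH⟩
  · refine ⟨H * S, ?_⟩
    have h := hH.mul hS
    rwa [show (fun a => ![0, 3, 2, 1] (![0, 2, 1, 3] a)) = (![0, 2, 3, 1] : Fin 4 → Fin 4) by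
      decide] at h
  · exact ⟨S, hS⟩
  · refine ⟨H * S * H, ?_⟩
    have h := (hH.mul hS).mul hH
    rwa [show (fun a => ![0, 3, 2, 1] (![0, 2, 1, 3] (![0, 3, 2, 1] a))) =
      (![0, 1, 3, 2] : Fin 4 → Fin 4) by decide] at h
  · refine ⟨S * H, ?_⟩
    have h := hS.mul hH
    rwa [show (fun a => ![0, 2, 1, 3] (![0, 3, 2, 1] a)) = (![0, 3, 1, 2] : Fin 4 → Fin 4) by
      decide] at h
  · exact ⟨1, isSiteClifford_one⟩

/-- The action on Pauli strings of one period of the Clifford circuit, up to signs. -/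
def periodMap {L : ℕ} (D : Finset (Site L)) (ε : Site L) (η : ZMod 2) (μ : Site L → Fin 4) :
    Site L → Fin 4 :=
  fun j => rotationMap D ε η 1 j
    (bondMap 1 (fun i => rotationMap D ε η 0 i (bondMap 0 μ i)) j)

/-- A doped site outside D' is made to act as an undoped one by a rotation that fixes the Pauli
matrices up to sign. -/
theorem exists_isClifford_floquetUnitary {L : ℕ} [NeZero L] {D D' : Finset (Site L)}
    (hD : D' ⊆ D) (ε : Site L) (η : ZMod 2) :
    ∃ V : Rotations D, IsClifford (floquetUnitary D V) (periodMap D' ε η) := by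
  choose V hV using exists_isSiteClifford_rotationMap D' ε η
  have hlayer : ∀ k : Fin 2, IsClifford
      (dopingLayer D (fun i => V (i.1 : ℕ) i.2) k) fun μ j => rotationMap D' ε η k j (μ j) := by
    intro k
    refine isClifford_siteLayer fun j => ?_
    by_cases h : j ∈ D
    · simpa [h] using hV k j
    · have h' : j ∉ D' := fun hj => h (hD hj)
      simpa [h, rotationMap, h'] using isSiteClifford_one
  exact ⟨fun i => V (i.1 : ℕ) i.2, ((hlayer 1).mul (isClifford_bondLayer 1)).mul
    ((hlayer 0).mul (isClifford_bondLayer 0))⟩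

/-- The soliton with its front at the site `x`. -/
def soliton {L : ℕ} (D : Finset (Site L)) (ε x j : Site L) : Fin 4 :=
  if j = x then (if j ∈ D then 2 else 1)
  else if j = x - ε then (if j ∈ D then 1 else 0)
  else if j = x - ε - ε then (if j ∈ D then (if j + ε ∈ D then 3 else 1) else 3)
  else 0

section

variable {L : ℕ} {D : Finset (Site L)} {ε x : Site L}

theorem soliton_front : soliton D ε x x = if x ∈ D then 2 else 1 := by
  simp [soliton]

theorem soliton_middle (h1 : ε ≠ 0) :
    soliton D ε x (x - ε) = if x - ε ∈ D then 1 else 0 := by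
  simp [soliton, h1]

theorem soliton_back (h1 : ε ≠ 0) (h2 : ε + ε ≠ 0) :
    soliton D ε x (x - ε - ε) =
      if x - ε - ε ∈ D then (if x - ε ∈ D then 3 else 1) else 3 := by
  have : x - ε - ε ≠ x := by rwa [sub_sub, ne_eq, sub_eq_self]
  simp [soliton, h1, this]

theorem soliton_eq_zero {j : Site L} (h0 : j ≠ x) (h1 : j ≠ x - ε) (h2 : j ≠ x - ε - ε) :
    soliton D ε x j = 0 := by
  simp [soliton, h0, h1, h2]

theorem soliton_ne_zero : soliton D ε x ≠ 0 := by
  intro h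
  have := congrFun h x
  rw [soliton_front, Pi.zero_apply] at this
  split_ifs at this <;> simp at this

theorem weight_soliton_le [NeZero L] : weight (soliton D ε x) ≤ 3 := by
  refine (Finset.card_le_card (t := {x, x - ε, x - ε - ε}) fun j hj => ?_).trans
    Finset.card_le_three
  by_contra h
  simp only [Finset.mem_insert, Finset.mem_singleton, not_or] at h
  exact (Finset.mem_filter.mp hj).2 (soliton_eq_zero h.1 h.2.1 h.2.2)

theorem weight_soliton_lt [NeZero L] (h1 : ε ≠ 0) (hx : x - ε ∉ D) :
    weight (soliton D ε x) < 3 := by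
  refine ((Finset.card_le_card (t := {x, x - ε - ε}) fun j hj => ?_).trans
    Finset.card_le_two).trans_lt (by norm_num)
  by_contra h
  simp only [Finset.mem_insert, Finset.mem_singleton, not_or] at h
  refine (Finset.mem_filter.mp hj).2 ?_
  by_cases hjx : j = x - ε
  · rw [hjx, soliton_middle h1, if_neg hx]
  · exact soliton_eq_zero h.1 hjx h.2

/-- The gate on {x, x + ε} moves the front: X becomes I, Z and Y becomes Z, X. The gate on {x - 2ε,
x - ε} clears the last site: X, I becomes I, Z and Z, X becomes I, Y (always up to sign). The
rotations repair the shape. A Hadamard turns the Z left at a doped x into the middle X. At a doped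
site of the other parity, one permutation has two tasks, one period apart: it sends the incoming
front, X or Z according to the doping of the site behind, to Y; and it sends the later Y to Z or X
according to the doping of the site ahead. -/
theorem soliton_step {η : ZMod 2} (hε : IsChirality ε η) (h1 : ε ≠ 0) (h2 : ε + ε ≠ 0)
    (h3 : ε + ε + ε ≠ 0) (hD : ∀ j, j ∉ D → j + ε ∈ D) {k : ℕ} (hx : parity L x = k + η) :
    (fun j => rotationMap D ε η k j (bondMap k (soliton D ε x) j)) = soliton D ε (x + ε) := by
  have hne : (k : ZMod 2) + η + 1 ≠ k + η := by simp
  have htwo : (k : ZMod 2) + η + 1 + 1 = k + η := by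
    rw [add_assoc]
    exact add_zero _
  have hD' : ∀ j, j ∉ D → j - ε ∈ D := fun j hj => by
    by_contra h
    exact hj (by simpa using hD _ h)
  have hpar1 : parity L (x + ε) = k + η + 1 := by rw [hε.parity_add, hx]
  have hpar2 : parity L (x - ε) = k + η + 1 := by rw [hε.parity_sub, hx]
  have hpar3 : parity L (x - ε - ε) = k + η := by rw [hε.parity_sub, hpar2, htwo]
  have hf := soliton_front (D := D) (ε := ε) (x := x)
  have hm := soliton_middle (D := D) (x := x) h1
  have hb := soliton_back (D := D) (x := x) h1 h2
  -- The site ahead must differ from the three sites of the soliton; this is where a chain of two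
  -- qubits is excluded.
  have hahead : soliton D ε x (x + ε) = 0 := by
    apply soliton_eq_zero
    · simpa using h1
    · intro h
      exact h2 (by linear_combination h)
    · intro h
      exact h3 (by linear_combination h)
  have hf' := soliton_front (D := D) (ε := ε) (x := x + ε)
  have hm' := soliton_middle (D := D) (x := x + ε) h1
  have hb' := soliton_back (D := D) (x := x + ε) h1 h2
  rw [add_sub_cancel_right] at hm' hb'
  ext1 j
  by_cases hj0 : j = x + ε
  · subst hj0
    rw [hf', bondMap, hε.partner_eq, hpar1, if_neg hne, add_sub_cancel_right, hahead, hf,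
      rotationMap, hpar1, if_neg hne, add_sub_cancel_right]
    by_cases hxD : x ∈ D
    · by_cases hyD : x + ε ∈ D
      · simp only [hxD, hyD, if_true]
        split_ifs <;> rfl
      · simp [hxD, hyD, gateMap]
    · have hyD := hD x hxD
      simp only [hxD, hyD, if_true]
      split_ifs <;> rfl
  by_cases hj1 : j = x
  · subst hj1
    rw [hm', bondMap, hε.partner_eq, hx, if_pos rfl, hahead, hf, rotationMap, hx, if_pos rfl]
    by_cases hxD : j ∈ D <;> simp [hxD, gateMap]
  by_cases hj2 : j = x - ε
  · subst hj2
    rw [hb', bondMap, hε.partner_eq, hpar2, if_neg hne, hm, hb, rotationMap, hpar2, if_neg hne,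
      sub_add_cancel]
    by_cases hyD : x - ε ∈ D
    · by_cases hzD : x - ε - ε ∈ D <;> by_cases hxD : x ∈ D <;>
        simp [hyD, hzD, hxD, gateMap]
    · have hzD := hD' _ hyD
      simp [hyD, hzD, gateMap]
  rw [soliton_eq_zero (x := x + ε) hj0 (by simpa using hj1) (by simpa using hj2)]
  have hrot : rotationMap D ε η k j 0 = 0 := by
    rw [rotationMap]
    split_ifs <;> rfl
  by_cases hj3 : j = x - ε - ε
  · subst hj3
    rw [bondMap, hε.partner_eq, hpar3, if_pos rfl, sub_add_cancel, hm, hb]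
    convert hrot using 2
    by_cases hyD : x - ε ∈ D
    · by_cases hzD : x - ε - ε ∈ D <;> simp [hyD, hzD, gateMap]
    · have hzD := hD' _ hyD
      simp [hyD, hzD, gateMap]
  -- The soliton and the site ahead fill exactly two bonds, so every other site has its partner
  -- outside the soliton as well.
  · rw [bondMap, soliton_eq_zero hj1 hj2 hj3, soliton_eq_zero]
    · exact hrot
    all_goals
      rw [hε.partner_eq]
      split_ifs with hp
      · intro h
        first
        | exact hj2 (by linear_combination h)
        | exact hj3 (by linear_combination h)
        | (have hj : j = x - ε - ε - ε := by linear_combination h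
           rw [hj, hε.parity_sub, hpar3] at hp
           exact hne hp)
      · intro h
        first
        | exact hj0 (by linear_combination h)
        | exact hj1 (by linear_combination h)
        | exact hj2 (by linear_combination h)

theorem periodMap_soliton {η : ZMod 2} (hε : IsChirality ε η) (h1 : ε ≠ 0) (h2 : ε + ε ≠ 0)
    (h3 : ε + ε + ε ≠ 0) (hD : ∀ j, j ∉ D → j + ε ∈ D) (hx : parity L x = η) :
    periodMap D ε η (soliton D ε x) = soliton D ε (x + ε + ε) := by
  have hs1 := soliton_step hε h1 h2 h3 hD (k := 0) (x := x) (by simpa using hx)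
  have hs2 := soliton_step hε h1 h2 h3 hD (k := 1) (x := x + ε)
    (by rw [hε.parity_add, hx, Nat.cast_one, add_comm])
  rw [← hs2, ← hs1]
  rfl

end

/-- A densely doped circuit of at least four qubits has Clifford rotations for which a Pauli string
has weight at most `3` throughout its orbit, and below `3` at some time. -/
theorem exists_light_orbit {L : ℕ} [NeZero L] (hL : 2 ≤ L) {D : Finset (Site L)}
    (hD : IsDenseDoping D) :
    ∃ (V : Rotations D) (σ : (Site L → Fin 4) → Site L → Fin 4) (μ : Site L → Fin 4),
      IsClifford (floquetUnitary D V) σ ∧ μ ≠ 0 ∧ weight μ < 3 ∧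
        ∀ t, weight (σ^[t] μ) ≤ 3 := by
  have hcast : ∀ m : ℕ, 0 < m → m < 4 → (m : Site L) ≠ 0 := by
    intro m hm hm4 h
    rw [ZMod.natCast_eq_zero_iff] at h
    have := Nat.le_of_dvd hm h
    omega
  -- A weight below 3 requires an undoped site. If all sites are doped, the site 0 is treated as
  -- undoped.
  obtain ⟨D', hsub, hdense, b, hb⟩ :
      ∃ D' ⊆ D, IsDenseDoping D' ∧ ∃ b, b ∉ D' := by
    by_cases h : ∃ b, b ∉ D
    · exact ⟨D, subset_rfl, hD, h⟩
    · push Not at h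
      refine ⟨D.erase 0, Finset.erase_subset _ _, fun j hj => ?_, 0, by simp⟩
      have hj0 : j = 0 := by simpa [h j] using hj
      simpa [hj0, h] using hcast 1 (by norm_num) (by norm_num)
  have hdense' : ∀ j, j ∉ D' → j + -1 ∈ D' := fun j hj => by
    by_contra h
    exact hj (by simpa using hdense _ h)
  -- Noise acts only once per period, when the middle of the soliton has parity η + 1. The direction
  -- is chosen so that b lies on this sublattice, and the soliton starts with its empty middle at b.
  obtain ⟨ε, η, hε, hbη, hDε⟩ : ∃ (ε : Site L) (η : ZMod 2), IsChirality ε η ∧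
      parity L b = η + 1 ∧ ∀ j, j ∉ D' → j + ε ∈ D' := by
    have hZ : ∀ a : ZMod 2, a = 0 + 1 ∨ a = 1 + 1 := by decide
    rcases hZ (parity L b) with h | h
    · exact ⟨1, 0, Or.inl ⟨rfl, rfl⟩, h, hdense⟩
    · exact ⟨-1, 1, Or.inr ⟨rfl, rfl⟩, h, hdense'⟩
  have hmul : ∀ m : ℕ, 0 < m → m < 4 → (m : Site L) * ε ≠ 0 := by
    intro m hm hm4
    rcases hε with ⟨rfl, -⟩ | ⟨rfl, -⟩ <;> simpa using hcast m hm hm4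
  have h1 : ε ≠ 0 := by simpa using hmul 1 (by norm_num) (by norm_num)
  have h2 : ε + ε ≠ 0 := by
    have := hmul 2 (by norm_num) (by norm_num)
    rwa [Nat.cast_ofNat, two_mul] at this
  have h3 : ε + ε + ε ≠ 0 := by
    have := hmul 3 (by norm_num) (by norm_num)
    rwa [Nat.cast_ofNat, show (3 : Site L) * ε = ε + ε + ε by ring] at this
  obtain ⟨V, hV⟩ := exists_isClifford_floquetUnitary hsub ε η
  refine ⟨V, periodMap D' ε η, soliton D' ε (b + ε), hV, soliton_ne_zero,
    weight_soliton_lt h1 (by simpa using hb), fun t => ?_⟩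
  have htwo : ∀ a : ZMod 2, a + 1 + 1 = a := by decide
  obtain ⟨y, -, hy⟩ : ∃ y, parity L y = η ∧
      (periodMap D' ε η)^[t] (soliton D' ε (b + ε)) = soliton D' ε y := by
    induction t with
    | zero => exact ⟨b + ε, by rw [hε.parity_add, hbη, htwo], rfl⟩
    | succ t ih =>
      obtain ⟨y, hy, ih⟩ := ih
      refine ⟨y + ε + ε, by rw [hε.parity_add, hε.parity_add, hy, htwo], ?_⟩
      rw [Function.iterate_succ_apply', ih, periodMap_soliton hε h1 h2 h3 hDε hy]
  rw [hy]
  exact weight_soliton_le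

/-- On two qubits every string has weight at most 2, so any Clifford rotations and any nontrivial
string will do. -/
theorem exists_light_orbit_two (D : Finset (Site 1)) :
    ∃ (V : Rotations D) (σ : (Site 1 → Fin 4) → Site 1 → Fin 4) (μ : Site 1 → Fin 4),
      IsClifford (floquetUnitary D V) σ ∧ μ ≠ 0 ∧ weight μ < 3 ∧
        ∀ t, weight (σ^[t] μ) ≤ 3 := by
  have hw : ∀ μ : Site 1 → Fin 4, weight μ ≤ 2 := fun μ =>
    (Finset.card_le_univ _).trans_eq (ZMod.card 2)
  obtain ⟨V, hV⟩ := exists_isClifford_floquetUnitary (Finset.empty_subset D) 1 0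
  exact ⟨V, _, fun _ => 1, hV, fun h => one_ne_zero (congrFun h 0), (hw _).trans_lt (by norm_num),
    fun t => (hw _).trans (by norm_num)⟩

end

end DopedClifford

theorem mainTheorem4 (L : ℕ) [NeZero L] (D : Finset (DopedClifford.Site L))
    (hD : DopedClifford.IsDenseDoping D) :
    ∀ᵐ V ∂(DopedClifford.haarRotations D), ∀ᶠ γ : ℝ in atTop,
      DopedClifford.liouvillianGap (DopedClifford.floquetChannel D V γ) ≤ 3 * γ + 3 := by
  obtain ⟨V₀, σ, μ, hσ, hμ, hlight, horbit⟩ :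
      ∃ (V : DopedClifford.Rotations D)
        (σ : (DopedClifford.Site L → Fin 4) → DopedClifford.Site L → Fin 4)
        (μ : DopedClifford.Site L → Fin 4),
        DopedClifford.IsClifford (DopedClifford.floquetUnitary D V) σ ∧ μ ≠ 0 ∧
          DopedClifford.weight μ < 3 ∧ ∀ t, DopedClifford.weight (σ^[t] μ) ≤ 3 := by
    rcases Nat.lt_or_ge L 2 with hL | hL
    · obtain rfl : L = 1 := by
        have := NeZero.ne L
        omega
      exact DopedClifford.exists_light_orbit_two D
    · exact DopedClifford.exists_light_orbit hL hD
  obtain ⟨n, s, hn, hs, hc⟩ := hσ.exists_coeff_trace_ne_zero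
    (DopedClifford.floquetUnitary_mul_conjTranspose D V₀) hμ hlight horbit
  -- At unitary matrices `periodOp` is `floquetUnitary` by definition, so `hc` and `hV` are
  -- statements about `loopAmplitude` as they stand.
  filter_upwards [DopedClifford.ae_loopAmplitude_ne_zero D n s V₀ hc] with V hV
  exact DopedClifford.eventually_liouvillianGap_le D V hn hs hV
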